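/- Let $\varphi>0$ be real, let $\vartheta\ge 0$ be an integer, let $g$ be analytic in a neighbourhood of $[-1,1]$ in the complex plane, and let $$u(x)=g(x)\,(1-x^2)^{\varphi}\,\log^{\vartheta}(1-x^2),\qquad x\in[-1,1]\quad(u(\pm1)=0).$$ Let $T_n$ be the Chebyshev polynomials and let $$a_n=\frac{2-\delta_{n,0}}{\pi}\int_{-1}^{1}\frac{u(x)T_n(x)}{\sqrt{1-x^2}}\,dx .$$ Let $b_n$ be the coefficients of $u$ in the difference basis $T_{n+2}-T_n$, i.e. $b_0=-a_0$, $b_1=-a_1$, $b_{n}=b_{n-2}-a_n$ for $n\ge2$. For $\varphi>1/2$ let $c_n$ be the coefficients of $u$ in the quadratic-factor basis $(1-x^2)T_n$, i.e. the Chebyshev coefficients of $u(x)/(1-x^2)$. Truncate the three expansions at degree $N$: $$u_N=\sum_{n=0}^{N}a_nT_n,\qquad u_N^{\rm diff}=\sum_{n=0}^{N-2}b_n\,(T_{n+2}-T_n),\qquad u_N^{\rm quad}=\sum_{n=0}^{N-2}c_n\,(1-x^2)\,T_n .$$ Call $A:\mathbb N\to\mathbb R$ slowly varying if it is eventually positive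 and, for every $\varepsilon>0$, eventually $n^{\varepsilon}A(n)$ is nondecreasing and $n^{-\varepsilon}A(n)$ is nonincreasing. Let $A_0(n)=\log^{\vartheta}n$ if $\varphi$ is not an integer, $A_0(n)=\log^{\vartheta-1}n$ if $\varphi$ is an integer and $\vartheta\ge1$, and $A_0(n)=1$ if $\vartheta=0$. Then $A_0$ is slowly varying, $a_n=O(A_0(n)/n^{2\varphi+1})$ as $n\to\infty$, and, for $A=A_0$ and more generally for every slowly varying $A$ with $a_n=O(A(n)/n^{2\varphi+1})$, the errors satisfy, as $N\to\infty$: 1. $\displaystyle E_N=\max_{x\in[-1,1]}|u(x)-u_N(x)|=O\!\left(A(N)/N^{2\varphi}\right)$; 2. $\displaystyle E_N^{\rm diff}=\max_{x\in[-1,1]}|u(x)-u_N^{\rm diff}(x)|=O\!\left(A(N)/N^{2\varphi}\right)$; 3. if $\varphi>1/2$, then $\displaystyle E_N^{\rm quad}=\max_{x\in[-1,1]}|u(x)-u_N^{\rm quad}(x)|=O\!\left(A(N)/N^{2\varphi-1}\right)$, a bound that is worse by one power of $N$. All the maxima are attained. -/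

import Mathlib

open Filter Asymptotics Set

noncomputable section

/-- The Chebyshev polynomial `T_n` as a real function. -/
def chebT (n : ℕ) (x : ℝ) : ℝ := (Polynomial.Chebyshev.T ℝ (n : ℤ)).eval x

/-- The `n`-th Chebyshev coefficient of `f` on `[-1, 1]`:
`(2/π) ∫ f(x) T_n(x) / √(1-x²) dx` for `n > 0`, and half of that expression for `n = 0`. -/
def chebCoeff (f : ℝ → ℂ) (n : ℕ) : ℂ :=
  (if n = 0 then ((1 / Real.pi : ℝ) : ℂ) else ((2 / Real.pi : ℝ) : ℂ)) *
    ∫ x in (-1 : ℝ)..1, f x * ((chebT n x / Real.sqrt (1 - x ^ 2) : ℝ) : ℂ)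

/-- The solution of `b_0 = -a_0`, `b_1 = -a_1`, `b_{n-2} - b_n = a_n` for `n ≥ 2`. -/
def diffRec (a : ℕ → ℂ) : ℕ → ℂ
  | 0 => -a 0
  | 1 => -a 1
  | n + 2 => diffRec a n - a (n + 2)

/-- Coefficients `b_n` of `u` in the difference basis `T_{n+2} - T_n`. -/
def diffCoeff (u : ℝ → ℂ) : ℕ → ℂ := diffRec (chebCoeff u)

/-- Coefficients `c_n` of `u` in the quadratic-factor basis `(1-x²) T_n`: the Chebyshev
coefficients of `u(x)/(1-x²)`. -/
def quadCoeff (u : ℝ → ℂ) : ℕ → ℂ := chebCoeff (fun x => u x / ((1 - x ^ 2 : ℝ) : ℂ))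

/-- `∑_{n=0}^{N} a_n T_n`. -/
def chebTrunc (u : ℝ → ℂ) (N : ℕ) (x : ℝ) : ℂ :=
  ∑ n ∈ Finset.range (N + 1), chebCoeff u n * (chebT n x : ℂ)

/-- `∑_{n=0}^{N-2} b_n (T_{n+2} - T_n)` (the empty sum if `N < 2`). -/
def diffTrunc (u : ℝ → ℂ) (N : ℕ) (x : ℝ) : ℂ :=
  ∑ n ∈ Finset.range (N - 1), diffCoeff u n * ((chebT (n + 2) x - chebT n x : ℝ) : ℂ)

/-- `∑_{n=0}^{N-2} c_n (1-x²) T_n` (the empty sum if `N < 2`). -/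
def quadTrunc (u : ℝ → ℂ) (N : ℕ) (x : ℝ) : ℂ :=
  ∑ n ∈ Finset.range (N - 1), quadCoeff u n * (((1 - x ^ 2) * chebT n x : ℝ) : ℂ)

/-- The set of pointwise errors `|u(x) - p(x)|`, `x ∈ [-1, 1]`. -/
def errorSet (u p : ℝ → ℂ) : Set ℝ := (fun x => ‖u x - p x‖) '' Icc (-1 : ℝ) 1

/-- The `L_∞` error on `[-1, 1]`. -/
def maxError (u p : ℝ → ℂ) : ℝ := sSup (errorSet u p)

/-- `u(x) = g(x) (1-x²)^φ log^ϑ(1-x²)`. -/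
def endpointSingular (g : ℂ → ℂ) (φ : ℝ) (ϑ : ℕ) (x : ℝ) : ℂ :=
  g (x : ℂ) * (((1 - x ^ 2) ^ φ * Real.log (1 - x ^ 2) ^ ϑ : ℝ) : ℂ)

/-- `A(n)` varies more slowly than any power of `n`: it is eventually positive and, for every
`ε > 0`, eventually `n^ε A(n)` is nondecreasing and `n^{-ε} A(n)` is nonincreasing. -/
def SlowlyVarying (A : ℕ → ℝ) : Prop :=
  (∀ᶠ n in atTop, 0 < A n) ∧
    ∀ ε : ℝ, 0 < ε → ∃ M : ℕ,
      MonotoneOn (fun n : ℕ => (n : ℝ) ^ ε * A n) (Ici M) ∧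
      AntitoneOn (fun n : ℕ => (n : ℝ) ^ (-ε) * A n) (Ici M)

open Classical in
/-- The logarithmic factor of the coefficients of `g(x) (1-x²)^φ log^ϑ(1-x²)`: `log^ϑ n` if `φ` is
not an integer, `log^{ϑ-1} n` if `φ` is an integer and `ϑ ≥ 1`, and `1` if `ϑ = 0`. -/
def logFactor (φ : ℝ) (ϑ : ℕ) (n : ℕ) : ℝ :=
  Real.log n ^ (if ∃ m : ℤ, φ = m then ϑ - 1 else ϑ)

/-- The error bounds for the three truncated expansions, with slowly varying factor `A`. The
coefficients `c_n` exist (the integrals converge) only if `φ > 1/2`. -/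
def TruncationErrorBounds (u : ℝ → ℂ) (φ : ℝ) (A : ℕ → ℝ) : Prop :=
  ((fun N => maxError u (chebTrunc u N)) =O[atTop]
      fun N : ℕ => A N / (N : ℝ) ^ (2 * φ)) ∧
  ((fun N => maxError u (diffTrunc u N)) =O[atTop]
      fun N : ℕ => A N / (N : ℝ) ^ (2 * φ)) ∧
  (1 / 2 < φ →
    (fun N => maxError u (quadTrunc u N)) =O[atTop]
      fun N : ℕ => A N / (N : ℝ) ^ (2 * φ - 1))

end

/-! Decay of the coefficients. With `x = cos θ` they become cosine integrals of `u (cos θ)`, and the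
singular factor becomes `w ^ (2φ) (2 log w) ^ ϑ` with `w = sin θ`. For `0 ≤ Re z ≤ π` the value `sin
z` stays in the closed right half-plane, so the principal branch continues `u ∘ cos` to a strip
whose only branch points are `0` and `π`. Split the cosine into exponentials and shift the `exp (i n
z)` part up and the `exp (-i n z)` part down. The horizontal sides are exponentially small. The
vertical sides combine into an integral, against `exp (-n t)`, of the jump of the factor between `i
s` and `-i s`, `s = sinh t` (`two_mul_cosIntegral_endpointSingular`). This jump is `O(s ^ (2φ) (|log
s| + 1) ^ k)`. If `φ` is an integer, the phases `exp (± i π φ)` agree and the highest power of the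
logarithm cancels, which accounts for the two cases of the logarithmic exponent. A Laplace estimate
concludes.

From coefficients to errors. `SlowlyVarying.exists_norm_le` is the common tool: a null sequence with
increments `O(A n / n ^ (p + 1))` is `O(A n / n ^ p)`, with constants independent of the sequence.
Applied to `u x - u_n x`, uniformly in `x`, it gives the Chebyshev bound. The difference truncation
differs from the Chebyshev one by two terms, whose coefficients are read off at `x = ±1`, where `u`
and the difference basis vanish. For the quadratic basis, `a` is `-1/4` times a second difference,
with step `2`, of `c`. Summing twice bounds `c n` by `A n / n ^ (2φ - 1)`, and the four boundary
terms of the truncation have this size; hence the lost power of `N`. That `c` tends to zero is the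
Riemann-Lebesgue lemma, applicable since `sin ^ (2φ - 2)`, up to logarithms, is integrable for `φ >
1/2`. -/

noncomputable section

/-! ### Summation against slowly varying factors -/

/-- The increments of `x ↦ -x ^ (-δ)` dominate `x ^ (-1 - δ)`. -/
theorem rpow_neg_one_sub_le {δ : ℝ} (hδ : 0 < δ) {m s : ℝ} (hm : 1 ≤ m) (hs : 1 ≤ s) :
    m ^ (-1 - δ) ≤ 2 * (1 + δ) / δ * (m ^ (-δ) - (m + s) ^ (-δ)) := by
  have hm0 : 0 < m := by linarith
  have h1 : (m + s) ^ (-δ) ≤ (m + 1) ^ (-δ) :=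
    Real.rpow_le_rpow_of_nonpos (by linarith) (by linarith) (by linarith)
  set t : ℝ := (m + 1) / m with ht
  have ht0 : 0 < t := by positivity
  have hmt : m + 1 = m * t := by rw [ht]; field_simp
  have hlog : 1 / (2 * m) ≤ Real.log t := by
    have := Real.one_sub_inv_le_log_of_pos ht0
    refine le_trans ?_ this
    rw [ht, inv_div, div_le_iff₀ (by positivity)]
    field_simp
    linarith
  have h2 : 1 + δ / (2 * m) ≤ t ^ δ := by
    rw [Real.rpow_def_of_pos ht0]
    have := Real.add_one_le_exp (Real.log t * δ)
    have h3 : δ / (2 * m) ≤ Real.log t * δ := by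
      calc δ / (2 * m) = 1 / (2 * m) * δ := by ring
        _ ≤ _ := by gcongr
    linarith
  have h3 : t ^ (-δ) ≤ 1 / (1 + δ / (2 * m)) := by
    rw [Real.rpow_neg ht0.le, ← one_div]
    gcongr
  have h4 : δ / (2 * (1 + δ)) * m⁻¹ ≤ 1 - t ^ (-δ) := by
    have : 1 - 1 / (1 + δ / (2 * m)) = δ / (2 * m + δ) := by field_simp; ring
    have h5 : δ / (2 * (1 + δ)) * m⁻¹ ≤ δ / (2 * m + δ) := by
      rw [← div_eq_mul_inv, div_div]
      gcongr
      nlinarith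
    linarith
  have h5 : m ^ (-1 - δ) = m ^ (-δ) * m⁻¹ := by
    rw [show -1 - δ = -δ + -1 by ring, Real.rpow_add hm0, Real.rpow_neg_one]
  have h6 : (m + 1) ^ (-δ) = m ^ (-δ) * t ^ (-δ) := by
    rw [hmt, Real.mul_rpow hm0.le ht0.le]
  calc m ^ (-1 - δ) = 2 * (1 + δ) / δ * (m ^ (-δ) * (δ / (2 * (1 + δ)) * m⁻¹)) := by
        rw [h5]; field_simp
    _ ≤ 2 * (1 + δ) / δ * (m ^ (-δ) * (1 - t ^ (-δ))) := by gcongr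
    _ = 2 * (1 + δ) / δ * (m ^ (-δ) - (m + 1) ^ (-δ)) := by rw [h6]; ring
    _ ≤ _ := by gcongr

/-- A null sequence is bounded by any nonnegative sequence whose decrements dominate its own. -/
theorem norm_le_of_norm_sub_le {E : Type*} [NormedAddCommGroup E] {f : ℕ → E} {B : ℕ → ℝ}
    {s N : ℕ} (hs : 1 ≤ s) (hf : Tendsto f atTop (nhds 0)) (hB : ∀ n, 0 ≤ B n)
    (h : ∀ n, N ≤ n → ‖f (n + s) - f n‖ ≤ B n - B (n + s)) : ‖f N‖ ≤ B N := by
  -- Telescoping along the progression `N + k s`; the first term vanishes in the limit and `B ≥ 0`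
  -- disposes of the last.
  have key : ∀ k : ℕ, ‖f N‖ ≤ ‖f (N + k * s)‖ + (B N - B (N + k * s)) := by
    intro k
    induction k with
    | zero => simp
    | succ k ih =>
      have h1 := h (N + k * s) (Nat.le_add_right _ _)
      have h2 : N + (k + 1) * s = N + k * s + s := by ring
      have h3 := norm_sub_norm_le (f (N + k * s)) (f (N + k * s + s))
      rw [norm_sub_rev] at h3
      rw [h2]
      linarith
  have hlim : Tendsto (fun k : ℕ => N + k * s) atTop atTop :=
    tendsto_atTop_mono (fun k => (Nat.le_mul_of_pos_right k hs).trans (Nat.le_add_left _ _)) tendsto_id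
  have hlim2 : Tendsto (fun k : ℕ => ‖f (N + k * s)‖ + B N) atTop (nhds (0 + B N)) :=
    ((tendsto_zero_iff_norm_tendsto_zero.1 hf).comp hlim).add tendsto_const_nhds
  rw [zero_add] at hlim2
  refine ge_of_tendsto' hlim2 fun k => ?_
  linarith [key k, hB (N + k * s)]

namespace SlowlyVarying

variable {A : ℕ → ℝ}

theorem exists_antitone_div (hA : SlowlyVarying A) {q : ℝ} (hq : 0 < q) :
    ∃ M : ℕ, ∀ m n : ℕ, M ≤ m → m ≤ n → A n / (n : ℝ) ^ q ≤ A m / (m : ℝ) ^ q := by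
  obtain ⟨M, -, hM⟩ := hA.2 q hq
  refine ⟨M, fun m n hm hmn => ?_⟩
  have h := hM (mem_Ici.2 hm) (mem_Ici.2 (hm.trans hmn)) hmn
  simp only [Real.rpow_neg (Nat.cast_nonneg _)] at h
  rwa [div_eq_inv_mul, div_eq_inv_mul]

/-- Shifting the argument changes `A n / n ^ q` at most by a bounded factor. -/
theorem exists_div_le_shift (hA : SlowlyVarying A) {q : ℝ} (hq : 0 < q) (j : ℕ) :
    ∃ K : ℝ, 0 < K ∧ ∃ M : ℕ, ∀ n : ℕ, M ≤ n →
      A n / (n : ℝ) ^ q ≤ K * (A (n + j) / ((n + j : ℕ) : ℝ) ^ q) := by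
  obtain ⟨M, hM, -⟩ := hA.2 1 one_pos
  obtain ⟨P, hP⟩ := eventually_atTop.1 hA.1
  -- Since `n A n` is eventually nondecreasing, only `n ^ (1 + q)` has to be compared, and `n + j ≤
  -- (1 + j) n` for `n ≥ 1`.
  refine ⟨(1 + j) ^ (1 + q), by positivity, max (max M P) 1, fun n hn => ?_⟩
  have hn1 : (1 : ℝ) ≤ n := by exact_mod_cast (le_max_right _ _).trans hn
  have hn0 : (0 : ℝ) < n := by linarith
  have h := hM (mem_Ici.2 (show M ≤ n by omega)) (mem_Ici.2 (show M ≤ n + j by omega))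
    (Nat.le_add_right n j)
  simp only [Real.rpow_one] at h
  have hpos : 0 < A (n + j) := hP _ (by omega)
  have hc : ((n + j : ℕ) : ℝ) ≤ (1 + j) * n := by push_cast; nlinarith [(Nat.cast_nonneg j : (0:ℝ) ≤ j)]
  have hc0 : (0 : ℝ) < ((n + j : ℕ) : ℝ) := by push_cast; positivity
  set c := ((n + j : ℕ) : ℝ)
  have e1 : A n / (n : ℝ) ^ q = (n * A n) / (n : ℝ) ^ (1 + q) := by
    rw [Real.rpow_add hn0, Real.rpow_one]; field_simp
  have e2 : A (n + j) / c ^ q = (c * A (n + j)) / c ^ (1 + q) := by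
    rw [Real.rpow_add hc0, Real.rpow_one]; field_simp
  have h2 : c ^ (1 + q) ≤ (1 + j : ℝ) ^ (1 + q) * (n : ℝ) ^ (1 + q) := by
    rw [← Real.mul_rpow (by positivity) hn0.le]
    exact Real.rpow_le_rpow hc0.le hc (by linarith)
  rw [e1, e2, ← mul_div_assoc, div_le_div_iff₀ (by positivity) (by positivity)]
  calc n * A n * c ^ (1 + q) ≤ (c * A (n + j)) * ((1 + j : ℝ) ^ (1 + q) * (n : ℝ) ^ (1 + q)) := by
        gcongr
    _ = _ := by ring

/-- Summation of `A n / n ^ (p + 1)`, in the form of a bound for null sequences. -/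
theorem exists_norm_le (hA : SlowlyVarying A) {p : ℝ} (hp : 0 < p) {s : ℕ} (hs : 1 ≤ s) :
    ∃ K : ℝ, 0 < K ∧ ∃ M : ℕ, ∀ N : ℕ, M ≤ N → ∀ (f : ℕ → ℂ) (C : ℝ), 0 ≤ C →
      Tendsto f atTop (nhds 0) →
      (∀ n, N ≤ n → ‖f (n + s) - f n‖ ≤ C * (A n / (n : ℝ) ^ (p + 1))) →
      ‖f N‖ ≤ K * C * (A N / (N : ℝ) ^ p) := by
  -- Half of the exponent `p` makes `A n / n ^ δ` nonincreasing, so that it can be frozen at `n =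
  -- N`; the other half is left for the telescoping sum of `n ^ (-1 - δ)`.
  set δ := p / 2 with hδ
  have hδ0 : 0 < δ := by positivity
  obtain ⟨M, hM⟩ := hA.exists_antitone_div hδ0
  obtain ⟨P, hP⟩ := eventually_atTop.1 hA.1
  refine ⟨2 * (1 + δ) / δ, by positivity, max (max M P) 1, fun N hN f C hC hf h => ?_⟩
  have hN1 : (1 : ℝ) ≤ N := by exact_mod_cast (le_max_right _ _).trans hN
  have hN0 : (0 : ℝ) < N := by linarith
  have hAN : 0 < A N := hP _ (by omega)
  set K := 2 * (1 + δ) / δ with hK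
  have hK0 : 0 < K := by positivity
  have := norm_le_of_norm_sub_le (N := N)
    (B := fun n => C * (A N / (N : ℝ) ^ δ) * (K * (n : ℝ) ^ (-δ))) hs hf
    (fun n => by positivity) (fun n hn => ?_)
  · refine this.trans (le_of_eq ?_)
    rw [show p = δ + δ by rw [hδ]; ring, Real.rpow_add hN0, Real.rpow_neg hN0.le]
    field_simp
  · have hn1 : (1 : ℝ) ≤ n := hN1.trans (by exact_mod_cast hn)
    have hn0 : (0 : ℝ) < n := by linarith
    have hs1 : (1 : ℝ) ≤ s := by exact_mod_cast hs
    refine (h n hn).trans ?_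
    have e : A n / (n : ℝ) ^ (p + 1) = A n / (n : ℝ) ^ δ * (n : ℝ) ^ (-1 - δ) := by
      rw [show -1 - δ = -(1 + δ) by ring, Real.rpow_neg hn0.le, ← div_eq_mul_inv, div_div,
        ← Real.rpow_add hn0, show δ + (1 + δ) = p + 1 by linarith]
    have h1 := hM N n (by omega) hn
    have h2 := rpow_neg_one_sub_le hδ0 hn1 hs1
    rw [e]
    push_cast
    calc C * (A n / (n : ℝ) ^ δ * (n : ℝ) ^ (-1 - δ))
        ≤ C * (A N / (N : ℝ) ^ δ * (K * ((n : ℝ) ^ (-δ) - (n + s : ℝ) ^ (-δ)))) := by gcongr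
      _ = _ := by ring

end SlowlyVarying

/-! ### Truncation in the Chebyshev and difference bases -/

theorem abs_chebT_le_one (n : ℕ) {x : ℝ} (hx : x ∈ Icc (-1 : ℝ) 1) : |chebT n x| ≤ 1 :=
  Polynomial.Chebyshev.abs_eval_T_real_le_one n (abs_le.2 hx)

theorem norm_mul_chebT_le (c : ℂ) (n : ℕ) {x : ℝ} (hx : x ∈ Icc (-1 : ℝ) 1) :
    ‖c * (chebT n x : ℂ)‖ ≤ ‖c‖ := by
  rw [norm_mul, Complex.norm_real, Real.norm_eq_abs]
  exact mul_le_of_le_one_right (norm_nonneg _) (abs_chebT_le_one n hx)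

/-- A uniform pointwise bound gives an asymptotic bound for the maximal errors. -/
theorem maxError_isBigO {u : ℝ → ℂ} {p : ℕ → ℝ → ℂ} {B : ℕ → ℝ} {K : ℝ}
    (h : ∀ᶠ N in atTop, ∀ x ∈ Icc (-1 : ℝ) 1, ‖u x - p N x‖ ≤ K * B N) :
    (fun N => maxError u (p N)) =O[atTop] B := by
  refine IsBigO.of_bound |K| ?_
  filter_upwards [h] with N hN
  have hne : (errorSet u (p N)).Nonempty := (nonempty_Icc.2 (by norm_num)).image _
  have h0 : 0 ≤ maxError u (p N) := by
    refine Real.sSup_nonneg ?_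
    rintro _ ⟨x, -, rfl⟩
    exact norm_nonneg _
  rw [Real.norm_of_nonneg h0]
  have h1 : maxError u (p N) ≤ K * B N := by
    refine csSup_le hne ?_
    rintro _ ⟨x, hx, rfl⟩
    exact hN x hx
  refine h1.trans ((le_abs_self _).trans ?_)
  rw [abs_mul, Real.norm_eq_abs]

theorem chebTrunc_succ (u : ℝ → ℂ) (N : ℕ) (x : ℝ) :
    chebTrunc u (N + 1) x = chebTrunc u N x + chebCoeff u (N + 1) * (chebT (N + 1) x : ℂ) := by
  rw [chebTrunc, Finset.sum_range_succ, chebTrunc]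

/-- For fixed `x` the remainders form a null sequence with increments `-a_{n+1} T_{n+1}(x)`, bounded
by `|a_{n+1}|`. The constants of `exists_norm_le` do not depend on the sequence, so the bound is
uniform in `x`. -/
theorem exists_norm_sub_chebTrunc_le {u : ℝ → ℂ} {p : ℝ} (hp : 0 < p) {A : ℕ → ℝ}
    (hA : SlowlyVarying A)
    (ha : (chebCoeff u) =O[atTop] fun n : ℕ => A n / (n : ℝ) ^ (p + 1))
    (hlim : ∀ x ∈ Icc (-1 : ℝ) 1, Tendsto (fun N => chebTrunc u N x) atTop (nhds (u x))) :
    ∃ K : ℝ, 0 < K ∧ ∀ᶠ N in atTop, ∀ x ∈ Icc (-1 : ℝ) 1,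
      ‖u x - chebTrunc u N x‖ ≤ K * (A N / (N : ℝ) ^ p) := by
  obtain ⟨C, hC, hCa⟩ := ha.exists_pos
  obtain ⟨K, hK, M, hM⟩ := hA.exists_norm_le hp le_rfl
  obtain ⟨M₁, hM₁⟩ := hA.exists_antitone_div (show 0 < p + 1 by linarith)
  obtain ⟨M₂, hM₂⟩ := eventually_atTop.1 (hCa.bound.and hA.1)
  refine ⟨K * C, by positivity, ?_⟩
  filter_upwards [eventually_ge_atTop (max M (max M₁ M₂))] with N hN x hx
  refine hM N (by omega) (fun n => u x - chebTrunc u n x) C hC.le ?_ fun n hn => ?_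
  · simpa using (hlim x hx).const_sub (u x)
  · obtain ⟨h1, h2⟩ := hM₂ (n + 1) (by omega)
    have h3 := hM₁ n (n + 1) (by omega) (by omega)
    rw [Real.norm_of_nonneg (by positivity)] at h1
    calc _ = ‖chebCoeff u (n + 1) * (chebT (n + 1) x : ℂ)‖ := by
          rw [chebTrunc_succ, ← norm_neg]; congr 1; ring
      _ ≤ ‖chebCoeff u (n + 1)‖ := norm_mul_chebT_le _ _ hx
      _ ≤ C * (A (n + 1) / ((n + 1 : ℕ) : ℝ) ^ (p + 1)) := h1
      _ ≤ _ := by gcongr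

/-- Summation by parts: `b_{n-2} - b_n = a_n` restores every Chebyshev coefficient except at the two
top degrees, where the subtracted `b_n` is missing. -/
theorem diffTrunc_add_one (u : ℝ → ℂ) (N : ℕ) (x : ℝ) :
    diffTrunc u (N + 1) x = chebTrunc u (N + 1) x + diffCoeff u N * (chebT N x : ℂ)
      + diffCoeff u (N + 1) * (chebT (N + 1) x : ℂ) := by
  induction N with
  | zero => simp [diffTrunc, chebTrunc, Finset.sum_range_succ, diffCoeff, diffRec]
  | succ N ih =>
    have h1 : diffTrunc u (N + 1 + 1) x = diffTrunc u (N + 1) x +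
        diffCoeff u N * ((chebT (N + 2) x - chebT N x : ℝ) : ℂ) := by
      simp [diffTrunc, Finset.sum_range_succ]
    have h2 : diffCoeff u (N + 1 + 1) = diffCoeff u N - chebCoeff u (N + 2) := rfl
    rw [h1, ih, chebTrunc_succ u (N + 1), h2]
    push_cast
    ring

theorem chebT_one (n : ℕ) : chebT n 1 = 1 := by simp [chebT]

theorem chebT_neg_one (n : ℕ) : chebT n (-1) = (-1) ^ n := by
  simp [chebT]

/-- If `u` vanishes at the endpoints, the coefficients in the difference basis are bounded by the
errors of the Chebyshev truncations at the endpoints. -/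
theorem norm_diffCoeff_le {u : ℝ → ℂ} (h1 : u 1 = 0) (h2 : u (-1) = 0) {N : ℕ} {ε : ℝ}
    (h : ∀ x ∈ Icc (-1 : ℝ) 1, ‖u x - chebTrunc u (N + 1) x‖ ≤ ε) :
    ‖diffCoeff u N‖ ≤ ε ∧ ‖diffCoeff u (N + 1)‖ ≤ ε := by
  have e1 := diffTrunc_add_one u N 1
  have e2 := diffTrunc_add_one u N (-1)
  have z1 : diffTrunc u (N + 1) 1 = 0 := by simp [diffTrunc, chebT_one]
  have z2 : diffTrunc u (N + 1) (-1) = 0 := by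
    simp [diffTrunc, chebT_neg_one, pow_add]
  have b1 := h 1 (by norm_num)
  have b2 := h (-1) (by norm_num)
  rw [h1, zero_sub, norm_neg] at b1
  rw [h2, zero_sub, norm_neg] at b2
  rw [z1, chebT_one, chebT_one] at e1
  rw [z2, chebT_neg_one, chebT_neg_one] at e2
  push_cast at e1 e2
  set S := chebTrunc u (N + 1) 1
  set S' := chebTrunc u (N + 1) (-1)
  set b := diffCoeff u N
  set b' := diffCoeff u (N + 1)
  have hsq : ((-1 : ℂ) ^ N) * (-1) ^ N = 1 := by rw [← mul_pow]; simp
  have hn : ‖(-1 : ℂ) ^ N * S'‖ ≤ ε := by simpa using b2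
  have e3 : b - b' = -((-1 : ℂ) ^ N * S') := by
    linear_combination (-1 : ℂ) ^ N * (-e2) - (b - b') * hsq
  -- The endpoints `1` and `-1` give `b + b'` and, up to sign, `b - b'`; both are values of
  -- truncation errors.
  have f1 : 2 * b = -S + -((-1 : ℂ) ^ N * S') := by linear_combination e3 - e1
  have f2 : 2 * b' = -S + ((-1 : ℂ) ^ N * S') := by linear_combination -e3 - e1
  have g1 : ‖2 * b‖ ≤ ε + ε := by
    rw [f1]; exact norm_add_le_of_le (by rwa [norm_neg]) (by rwa [norm_neg])
  have g2 : ‖2 * b'‖ ≤ ε + ε := by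
    rw [f2]; exact norm_add_le_of_le (by rwa [norm_neg]) hn
  rw [norm_mul, Complex.norm_ofNat] at g1 g2
  constructor <;> linarith

theorem norm_sub_diffTrunc_le {u : ℝ → ℂ} (h1 : u 1 = 0) (h2 : u (-1) = 0) {N : ℕ} {ε : ℝ}
    (h : ∀ x ∈ Icc (-1 : ℝ) 1, ‖u x - chebTrunc u (N + 1) x‖ ≤ ε) {x : ℝ}
    (hx : x ∈ Icc (-1 : ℝ) 1) : ‖u x - diffTrunc u (N + 1) x‖ ≤ 3 * ε := by
  obtain ⟨b1, b2⟩ := norm_diffCoeff_le h1 h2 h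
  have e : u x - diffTrunc u (N + 1) x = (u x - chebTrunc u (N + 1) x)
      - diffCoeff u N * (chebT N x : ℂ) - diffCoeff u (N + 1) * (chebT (N + 1) x : ℂ) := by
    rw [diffTrunc_add_one]; ring
  rw [e]
  have := norm_sub_le_of_le (norm_sub_le_of_le (h x hx) ((norm_mul_chebT_le _ N hx).trans b1))
    ((norm_mul_chebT_le _ (N + 1) hx).trans b2)
  linarith

/-! ### Truncation in the quadratic-factor basis -/

/-- The factor `2 x ^ 2 - 1` is `T_2`, so this expresses `(1 - x ^ 2) T_{n+2}` through `T_n`,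
`T_{n+2}` and `T_{n+4}`. -/
theorem chebT_recurrence (n : ℕ) (x : ℝ) :
    chebT (n + 4) x = 2 * (2 * x ^ 2 - 1) * chebT (n + 2) x - chebT n x := by
  simp only [chebT, Nat.cast_add, Nat.cast_ofNat]
  have e1 := Polynomial.Chebyshev.T_add_two ℝ (n : ℤ)
  have e2 := Polynomial.Chebyshev.T_add_two ℝ (n + 1 : ℤ)
  have e3 := Polynomial.Chebyshev.T_add_two ℝ (n + 2 : ℤ)
  rw [show (n : ℤ) + 1 + 2 = n + 3 by ring, show (n : ℤ) + 1 + 1 = n + 2 by ring] at e2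
  rw [show (n : ℤ) + 2 + 2 = n + 4 by ring, show (n : ℤ) + 2 + 1 = n + 3 by ring] at e3
  rw [e3, e2]
  have e1' := congrArg (Polynomial.eval x) e1
  simp only [Polynomial.eval_sub, Polynomial.eval_mul, Polynomial.eval_X,
    Polynomial.eval_ofNat] at e1' ⊢
  linear_combination e1'

/-- The relations between the Chebyshev coefficients `a` of `u` and `c` of `u / (1 - x ^ 2)`. -/
structure QuadRelations (a c : ℕ → ℂ) : Prop where
  zero : a 0 = c 0 / 2 - c 2 / 4
  one : a 1 = c 1 / 4 - c 3 / 4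
  two : a 2 = c 2 / 2 - c 0 / 2 - c 4 / 4
  add_three : ∀ n, a (n + 3) = c (n + 3) / 2 - c (n + 1) / 4 - c (n + 5) / 4

/-- Cutting the sum after `c_{N+2}` leaves two kinds of boundary terms: degrees `N + 1`, `N + 2`
lack the contributions of `c_{N+3}`, `c_{N+4}`, and `c_{N+1}`, `c_{N+2}` spill over into degrees `N
+ 3`, `N + 4`. -/
theorem quadTrunc_eq {u : ℝ → ℂ} (hr : QuadRelations (chebCoeff u) (quadCoeff u)) (N : ℕ) (x : ℝ) :
    quadTrunc u (N + 4) x = chebTrunc u (N + 2) x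
      + quadCoeff u (N + 3) / 4 * (chebT (N + 1) x : ℂ)
      + quadCoeff u (N + 4) / 4 * (chebT (N + 2) x : ℂ)
      - quadCoeff u (N + 1) / 4 * (chebT (N + 3) x : ℂ)
      - quadCoeff u (N + 2) / 4 * (chebT (N + 4) x : ℂ) := by
  induction N with
  | zero =>
    have t0 : chebT 0 x = 1 := by simp [chebT]
    have t1 : chebT 1 x = x := by simp [chebT]
    have t2 : chebT 2 x = 2 * x ^ 2 - 1 := by simp [chebT, Polynomial.Chebyshev.T_two]
    have t3 : chebT 3 x = 4 * x ^ 3 - 3 * x := by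
      have := Polynomial.Chebyshev.T_add_two ℝ 1
      rw [show (1 : ℤ) + 2 = 3 by ring, show (1 : ℤ) + 1 = 2 by ring] at this
      simp [chebT, Polynomial.Chebyshev.T_two, this]
      ring
    have t4 := chebT_recurrence 0 x
    simp only [zero_add] at t4 ⊢
    simp only [quadTrunc, chebTrunc, Finset.sum_range_succ, Finset.sum_range_zero, hr.zero, hr.one,
      hr.two, t4, t3, t2, t1, t0, Nat.reduceSub, Nat.reduceAdd, zero_add]
    push_cast
    ring
  | succ N ih =>
    have h1 : quadTrunc u (N + 1 + 4) x = quadTrunc u (N + 4) x +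
        quadCoeff u (N + 3) * (((1 - x ^ 2) * chebT (N + 3) x : ℝ) : ℂ) := by
      simp [quadTrunc, Finset.sum_range_succ]
    have h2 := chebT_recurrence (N + 1) x
    rw [h1, ih, show N + 1 + 2 = N + 2 + 1 by ring, chebTrunc_succ u (N + 2),
      show N + 2 + 1 = N + 3 by ring, hr.add_three]
    rw [show N + 1 + 4 = N + 5 by ring, show N + 1 + 2 = N + 3 by ring] at h2
    simp only [show N + 1 + 4 = N + 5 by ring, show N + 1 + 3 = N + 4 by ring,
      show N + 1 + 1 = N + 2 by ring, h2]
    push_cast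
    ring

/-- The step-two second difference of `c` is `-4 a`. Two summations, first of the differences and
then of `c` itself, cost one power of `n` each; the second needs `p - 1 > 0`. -/
theorem exists_norm_quadCoeff_le {u : ℝ → ℂ} {p : ℝ} (hp : 1 < p) {A : ℕ → ℝ}
    (hA : SlowlyVarying A)
    (ha : (chebCoeff u) =O[atTop] fun n : ℕ => A n / (n : ℝ) ^ (p + 1))
    (hr : QuadRelations (chebCoeff u) (quadCoeff u))
    (hc : Tendsto (quadCoeff u) atTop (nhds 0)) :
    ∃ K : ℝ, 0 < K ∧ ∀ᶠ n in atTop, ‖quadCoeff u n‖ ≤ K * (A n / (n : ℝ) ^ (p - 1)) := by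
  obtain ⟨C, hC, hCa⟩ := ha.exists_pos
  obtain ⟨K, hK, M, hM⟩ := hA.exists_norm_le (show 0 < p by linarith) one_le_two
  obtain ⟨K', hK', M', hM'⟩ := hA.exists_norm_le (show 0 < p - 1 by linarith) one_le_two
  obtain ⟨M₁, hM₁⟩ := hA.exists_antitone_div (show 0 < p + 1 by linarith)
  obtain ⟨M₂, hM₂⟩ := eventually_atTop.1 (hCa.bound.and hA.1)
  have hd : ∀ n, max (max M 1) (max M₁ M₂) ≤ n →
      ‖quadCoeff u (n + 2) - quadCoeff u n‖ ≤ K * (4 * C) * (A n / (n : ℝ) ^ (p - 1 + 1)) := by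
    intro n hn
    rw [sub_add_cancel]
    refine hM n (by omega) (fun n => quadCoeff u (n + 2) - quadCoeff u n) (4 * C) (by positivity)
      ?_ fun m hm => ?_
    · simpa using ((tendsto_add_atTop_iff_nat 2).2 hc).sub hc
    · obtain ⟨h1, h2⟩ := hM₂ (m + 2) (by omega)
      have h3 := hM₁ m (m + 2) (by omega) (by omega)
      rw [Real.norm_of_nonneg (by positivity)] at h1
      -- The general relation starts at `a_3`, so `m ≥ 1` is needed; the maximum with `1` in the
      -- threshold ensures it.
      obtain ⟨k, rfl⟩ : ∃ k, m = k + 1 := ⟨m - 1, by omega⟩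
      have h4 := hr.add_three k
      calc _ = ‖-4 * chebCoeff u (k + 1 + 2)‖ := by
            congr 1
            rw [show k + 1 + 2 = k + 3 by ring, h4, show k + 3 + 2 = k + 5 by ring]
            ring
        _ = 4 * ‖chebCoeff u (k + 1 + 2)‖ := by simp
        _ ≤ 4 * (C * (A (k + 1 + 2) / ((k + 1 + 2 : ℕ) : ℝ) ^ (p + 1))) := by gcongr
        _ ≤ _ := by rw [mul_assoc]; gcongr
  refine ⟨K' * (K * (4 * C)), by positivity, ?_⟩
  filter_upwards [eventually_ge_atTop (max M' (max (max M 1) (max M₁ M₂)))] with n hn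
  exact hM' n (by omega) _ _ (by positivity) hc fun m hm => hd m (by omega)

theorem exists_norm_sub_quadTrunc_le {u : ℝ → ℂ} {p : ℝ} (hp : 1 < p) {A : ℕ → ℝ}
    (hA : SlowlyVarying A)
    (ha : (chebCoeff u) =O[atTop] fun n : ℕ => A n / (n : ℝ) ^ (p + 1))
    (hlim : ∀ x ∈ Icc (-1 : ℝ) 1, Tendsto (fun N => chebTrunc u N x) atTop (nhds (u x)))
    (hr : QuadRelations (chebCoeff u) (quadCoeff u))
    (hc : Tendsto (quadCoeff u) atTop (nhds 0)) :
    ∃ K : ℝ, ∀ᶠ N in atTop, ∀ x ∈ Icc (-1 : ℝ) 1,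
      ‖u x - quadTrunc u N x‖ ≤ K * (A N / (N : ℝ) ^ (p - 1)) := by
  have hp1 : 0 < p - 1 := by linarith
  obtain ⟨K, hK, hE⟩ := exists_norm_sub_chebTrunc_le (show 0 < p by linarith) hA ha hlim
  obtain ⟨K', hK', hQ⟩ := exists_norm_quadCoeff_le hp hA ha hr hc
  -- The boundary coefficients have indices `n + 1` to `n + 4`; all bounds are moved to index `n +
  -- 4`, the degree of truncation.
  have hsh : ∀ j : ℕ, j ≤ 3 → ∃ L : ℝ, 0 < L ∧ ∀ᶠ n : ℕ in atTop,
      A (n + (4 - j)) / ((n + (4 - j) : ℕ) : ℝ) ^ (p - 1) ≤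
        L * (A (n + 4) / ((n + 4 : ℕ) : ℝ) ^ (p - 1)) := by
    intro j hj
    obtain ⟨L, hL, M, hM⟩ := hA.exists_div_le_shift hp1 j
    refine ⟨L, hL, ?_⟩
    filter_upwards [eventually_ge_atTop M] with n hn
    have := hM (n + (4 - j)) (by omega)
    rwa [show n + (4 - j) + j = n + 4 by omega] at this
  obtain ⟨L₁, hL₁, h₁⟩ := hsh 3 (by norm_num)
  obtain ⟨L₂, hL₂, h₂⟩ := hsh 2 (by norm_num)
  obtain ⟨L₃, hL₃, h₃⟩ := hsh 1 (by norm_num)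
  have sh : ∀ k {P : ℕ → Prop}, (∀ᶠ n in atTop, P n) → ∀ᶠ n in atTop, P (n + k) :=
    fun k P h => (tendsto_add_atTop_nat k).eventually h
  refine ⟨K * L₂ + K' * L₃ + K' + K' * L₁ + K' * L₂, ?_⟩
  have main : ∀ᶠ n in atTop, ∀ x ∈ Icc (-1 : ℝ) 1, ‖u x - quadTrunc u (n + 4) x‖ ≤
      (K * L₂ + K' * L₃ + K' + K' * L₁ + K' * L₂) *
        (A (n + 4) / ((n + 4 : ℕ) : ℝ) ^ (p - 1)) := by
    filter_upwards [h₁, h₂, h₃, sh 2 hE, sh 1 hQ, sh 2 hQ, sh 3 hQ, sh 4 hQ, sh 2 hA.1]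
      with n g₁ g₂ g₃ gE q₁ q₂ q₃ q₄ hpos x hx
    simp only [Nat.reduceSub] at g₁ g₂ g₃
    set X := A (n + 4) / ((n + 4 : ℕ) : ℝ) ^ (p - 1)
    have w : ∀ (m k : ℕ) (Y : ℝ), ‖quadCoeff u m‖ ≤ Y →
        ‖quadCoeff u m / 4 * (chebT k x : ℂ)‖ ≤ Y := fun m k Y hY => by
      refine (norm_mul_chebT_le _ k hx).trans ?_
      rw [norm_div, Complex.norm_ofNat]
      linarith [norm_nonneg (quadCoeff u m)]
    have e : A (n + 2) / ((n + 2 : ℕ) : ℝ) ^ p ≤ A (n + 2) / ((n + 2 : ℕ) : ℝ) ^ (p - 1) := by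
      have : (1 : ℝ) ≤ ((n + 2 : ℕ) : ℝ) := by push_cast; linarith [(Nat.cast_nonneg n : (0 : ℝ) ≤ n)]
      have h0 : ((n + 2 : ℕ) : ℝ) ^ (p - 1) ≤ ((n + 2 : ℕ) : ℝ) ^ p :=
        Real.rpow_le_rpow_of_exponent_le this (by linarith)
      gcongr
    have eE := (gE x hx).trans (mul_le_mul_of_nonneg_left (e.trans g₂) hK.le)
    have e1 := q₁.trans (mul_le_mul_of_nonneg_left g₁ hK'.le)
    have e2 := q₂.trans (mul_le_mul_of_nonneg_left g₂ hK'.le)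
    have e3 := q₃.trans (mul_le_mul_of_nonneg_left g₃ hK'.le)
    have hu : u x - quadTrunc u (n + 4) x = u x - chebTrunc u (n + 2) x
      - quadCoeff u (n + 3) / 4 * (chebT (n + 1) x : ℂ)
      - quadCoeff u (n + 4) / 4 * (chebT (n + 2) x : ℂ)
      + quadCoeff u (n + 1) / 4 * (chebT (n + 3) x : ℂ)
      + quadCoeff u (n + 2) / 4 * (chebT (n + 4) x : ℂ) := by
      rw [quadTrunc_eq hr]; ring
    rw [hu]
    have := norm_add_le_of_le (norm_add_le_of_le (norm_sub_le_of_le (norm_sub_le_of_le eE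
      (w _ (n + 1) _ e3)) (w _ (n + 2) _ q₄)) (w _ (n + 3) _ e1)) (w _ (n + 4) _ e2)
    refine this.trans (le_of_eq ?_)
    ring
  obtain ⟨M, hM⟩ := eventually_atTop.1 main
  filter_upwards [eventually_ge_atTop (M + 4)] with N hN
  obtain ⟨n, rfl⟩ : ∃ n, N = n + 4 := ⟨N - 4, by omega⟩
  exact hM n (by omega)

theorem truncationErrorBounds {u : ℝ → ℂ} {φ : ℝ} (hφ : 0 < φ) {A : ℕ → ℝ}
    (hA : SlowlyVarying A)
    (ha : (chebCoeff u) =O[atTop] fun n : ℕ => A n / (n : ℝ) ^ (2 * φ + 1))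
    (hlim : ∀ x ∈ Icc (-1 : ℝ) 1, Tendsto (fun N => chebTrunc u N x) atTop (nhds (u x)))
    (h1 : u 1 = 0) (h2 : u (-1) = 0)
    (hq : 1 / 2 < φ → QuadRelations (chebCoeff u) (quadCoeff u) ∧
      Tendsto (quadCoeff u) atTop (nhds 0)) :
    TruncationErrorBounds u φ A := by
  obtain ⟨K, hK, hE⟩ := exists_norm_sub_chebTrunc_le (show 0 < 2 * φ by linarith) hA ha hlim
  refine ⟨maxError_isBigO hE, maxError_isBigO (K := 3 * K) ?_, fun h => ?_⟩
  · filter_upwards [hE, eventually_ge_atTop 1] with N hN hN1 x hx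
    obtain ⟨n, rfl⟩ : ∃ n, N = n + 1 := ⟨N - 1, by omega⟩
    rw [mul_assoc]
    exact norm_sub_diffTrunc_le h1 h2 hN hx
  · obtain ⟨hr, hc⟩ := hq h
    obtain ⟨K', hK'⟩ :=
      exists_norm_sub_quadTrunc_le (show 1 < 2 * φ by linarith) hA ha hlim hr hc
    exact maxError_isBigO hK'

/-! ### Cosine integrals and the relations between coefficients -/

/-- The cosine integrals `∫ f (cos θ) cos (k θ)` over `[0, π]`. -/
def cosIntegral (f : ℝ → ℂ) (k : ℤ) : ℂ :=
  ∫ θ in (0 : ℝ)..Real.pi, f (Real.cos θ) * (Real.cos (k * θ) : ℂ)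

theorem cosIntegral_neg (f : ℝ → ℂ) (k : ℤ) : cosIntegral f (-k) = cosIntegral f k := by
  simp [cosIntegral]

theorem chebT_cos (n : ℕ) (θ : ℝ) : chebT n (Real.cos θ) = Real.cos (n * θ) := by
  simp [chebT]

theorem cos_image_Ioo : Real.cos '' Ioo 0 Real.pi = Ioo (-1) 1 := by
  ext x
  constructor
  · rintro ⟨θ, ⟨h0, h1⟩, rfl⟩
    refine ⟨?_, ?_⟩
    · rw [← Real.cos_pi]
      exact Real.strictAntiOn_cos ⟨h0.le, h1.le⟩ ⟨Real.pi_pos.le, le_rfl⟩ h1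
    · rw [← Real.cos_zero]
      exact Real.strictAntiOn_cos ⟨le_rfl, Real.pi_pos.le⟩ ⟨h0.le, h1.le⟩ h0
  · rintro ⟨h0, h1⟩
    exact ⟨Real.arccos x, ⟨Real.arccos_pos.2 h1, Real.arccos_lt_pi.2 h0⟩,
      Real.cos_arccos h0.le h1.le⟩

/-- Substituting `x = cos θ` cancels the weight against the Jacobian `sin θ`. On open intervals `sin
θ` is nonzero, and the change of variables requires no integrability. -/
theorem integral_chebT_div_sqrt (f : ℝ → ℂ) (n : ℕ) :
    ∫ x in (-1 : ℝ)..1, f x * ((chebT n x / Real.sqrt (1 - x ^ 2) : ℝ) : ℂ) = cosIntegral f n := by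
  rw [cosIntegral, intervalIntegral.integral_of_le (by norm_num),
    intervalIntegral.integral_of_le Real.pi_pos.le, MeasureTheory.integral_Ioc_eq_integral_Ioo,
    MeasureTheory.integral_Ioc_eq_integral_Ioo, ← cos_image_Ioo,
    MeasureTheory.integral_image_eq_integral_abs_deriv_smul measurableSet_Ioo
      (fun θ _ => (Real.hasDerivAt_cos θ).hasDerivWithinAt)
      (Real.injOn_cos.mono Ioo_subset_Icc_self)]
  refine MeasureTheory.setIntegral_congr_fun measurableSet_Ioo fun θ hθ => ?_
  have hs : 0 < Real.sin θ := Real.sin_pos_of_pos_of_lt_pi hθ.1 hθ.2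
  have hs' : (Real.sin θ : ℂ) ≠ 0 := by exact_mod_cast hs.ne'
  rw [abs_neg, abs_of_pos hs, chebT_cos, ← Real.sin_sq, Real.sqrt_sq hs.le, Complex.real_smul]
  push_cast at hs' ⊢
  field_simp

theorem chebCoeff_zero (f : ℝ → ℂ) : chebCoeff f 0 = 1 / Real.pi * cosIntegral f 0 := by
  simpa [chebCoeff] using congrArg (fun z : ℂ => (Real.pi : ℂ)⁻¹ * z) (integral_chebT_div_sqrt f 0)

theorem chebCoeff_succ (f : ℝ → ℂ) (n : ℕ) :
    chebCoeff f (n + 1) = 2 / Real.pi * cosIntegral f (n + 1) := by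
  rw [chebCoeff, integral_chebT_div_sqrt]
  simp

theorem intervalIntegrable_mul_cos {f : ℝ → ℂ} {a b : ℝ} (hf : IntervalIntegrable f MeasureTheory.volume a b)
    (k : ℝ) : IntervalIntegrable (fun θ => f θ * (Real.cos (k * θ) : ℂ)) MeasureTheory.volume a b :=
  hf.mul_continuousOn (by fun_prop)

/-- This is `sin² θ cos kθ = cos kθ / 2 - cos (k+2)θ / 4 - cos (k-2)θ / 4`. Integer frequencies
allow `k - 2` to be negative. -/
theorem cosIntegral_eq_of_mul_sin_sq {u v : ℝ → ℂ}
    (huv : ∀ θ ∈ Ioo 0 Real.pi, u (Real.cos θ) = v (Real.cos θ) * ((Real.sin θ ^ 2 : ℝ) : ℂ))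
    (hv : IntervalIntegrable (fun θ => v (Real.cos θ)) MeasureTheory.volume 0 Real.pi) (k : ℤ) :
    cosIntegral u k =
      cosIntegral v k / 2 - cosIntegral v (k + 2) / 4 - cosIntegral v (k - 2) / 4 := by
  simp only [cosIntegral]
  have i := fun k : ℤ => intervalIntegrable_mul_cos hv k
  rw [← intervalIntegral.integral_div, ← intervalIntegral.integral_div,
    ← intervalIntegral.integral_div, ← intervalIntegral.integral_sub ((i k).div_const _)
      ((i (k + 2)).div_const _), ← intervalIntegral.integral_sub
      (((i k).div_const _).sub ((i (k + 2)).div_const _)) ((i (k - 2)).div_const _)]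
  refine intervalIntegral.integral_congr_Ioo_of_le Real.pi_pos.le fun θ hθ => ?_
  have e1 : Real.cos (((k + 2 : ℤ) : ℝ) * θ) + Real.cos (((k - 2 : ℤ) : ℝ) * θ) =
      2 * (Real.cos (k * θ) * (1 - 2 * Real.sin θ ^ 2)) := by
    push_cast
    rw [add_mul, sub_mul, Real.cos_add, Real.cos_sub, Real.cos_two_mul, Real.sin_sq]
    ring
  have e2 : (Real.cos (((k + 2 : ℤ) : ℝ) * θ) : ℂ) = 2 * (Real.cos (k * θ) *
      (1 - 2 * (Real.sin θ : ℂ) ^ 2)) - Real.cos (((k - 2 : ℤ) : ℝ) * θ) := by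
    rw [eq_sub_iff_add_eq]
    exact_mod_cast e1
  rw [huv θ hθ, e2]
  push_cast
  ring

/-- The first three relations are exceptional because the frequencies `-2` and `-1` fold back by
evenness and the coefficient of index `0` carries half the usual normalisation. -/
theorem quadRelations_of_cosIntegral {u v : ℝ → ℂ}
    (h : ∀ k : ℤ, cosIntegral u k =
      cosIntegral v k / 2 - cosIntegral v (k + 2) / 4 - cosIntegral v (k - 2) / 4) :
    QuadRelations (chebCoeff u) (chebCoeff v) := by
  have s := fun (f : ℝ → ℂ) (n : ℕ) => chebCoeff_succ f n
  have n1 := cosIntegral_neg v 1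
  have n2 := cosIntegral_neg v 2
  refine ⟨?_, ?_, ?_, fun n => ?_⟩
  · have := h 0
    norm_num [n2] at this
    rw [chebCoeff_zero, chebCoeff_zero, s v 1, this]
    norm_num
    ring
  · have := h 1
    norm_num [n1] at this
    rw [s u 0, s v 0, s v 2]
    norm_num
    rw [this]
    ring
  · have := h 2
    norm_num at this
    rw [s u 1, s v 1, s v 3, chebCoeff_zero]
    norm_num
    rw [this]
    ring
  · have := h (n + 3)
    rw [s u (n + 2), s v (n + 2), s v n, s v (n + 4)]
    push_cast
    rw [show (n : ℤ) + 2 + 1 = n + 3 by ring, show (n : ℤ) + 4 + 1 = n + 5 by ring, this,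
      show (n : ℤ) + 3 + 2 = n + 5 by ring, show (n : ℤ) + 3 - 2 = n + 1 by ring]
    ring

/-- The Riemann-Lebesgue lemma for the Chebyshev coefficients. -/
theorem tendsto_chebCoeff_zero {v : ℝ → ℂ}
    (hv : IntervalIntegrable (fun θ => v (Real.cos θ)) MeasureTheory.volume 0 Real.pi) :
    Tendsto (chebCoeff v) atTop (nhds 0) := by
  set w : ℝ → ℂ := (Ioc 0 Real.pi).indicator fun θ => v (Real.cos θ) with hw
  have hwi : MeasureTheory.Integrable w := by
    rw [hw, MeasureTheory.integrable_indicator_iff measurableSet_Ioc]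
    exact hv.1
  have RL := Real.tendsto_integral_exp_smul_cocompact w
  set R : ℝ → ℂ := fun y => ∫ x, Real.fourierChar (-(x * y)) • w x with hR
  -- The cosine is the mean of the two characters of frequency `± n / (2π)` in the normalisation
  -- `exp (2π i x)`.
  have key : ∀ n : ℕ, cosIntegral v n =
      (R (n / (2 * Real.pi)) + R (-(n / (2 * Real.pi)))) / 2 := by
    intro n
    have hi : ∀ y : ℝ, MeasureTheory.Integrable fun x => Real.fourierChar (-(x * y)) • w x := by
      intro y
      have := (Real.fourierIntegral_convergent_iff (μ := MeasureTheory.volume) (f := w) y).2 hwi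
      simpa [mul_comm] using this
    rw [hR]
    simp only
    rw [← MeasureTheory.integral_add (hi _) (hi _), ← MeasureTheory.integral_div, cosIntegral,
      intervalIntegral.integral_of_le Real.pi_pos.le,
      ← MeasureTheory.integral_indicator measurableSet_Ioc]
    congr 1
    ext θ
    by_cases hθ : θ ∈ Ioc 0 Real.pi
    · rw [indicator_of_mem hθ, hw, indicator_of_mem hθ]
      simp only [Circle.smul_def, Real.fourierChar_apply, smul_eq_mul]
      rw [Complex.ofReal_cos, Complex.cos]
      have e : (2 * Real.pi : ℂ) ≠ 0 := by simp [Real.pi_ne_zero]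
      have e1 : ((2 * Real.pi * -(θ * (n / (2 * Real.pi))) : ℝ) : ℂ) * Complex.I
          = -(((n : ℤ) : ℝ) * θ : ℝ) * Complex.I := by
        push_cast; field_simp
      have e2 : ((2 * Real.pi * -(θ * -(n / (2 * Real.pi))) : ℝ) : ℂ) * Complex.I
          = (((n : ℤ) : ℝ) * θ : ℝ) * Complex.I := by
        push_cast; field_simp
      rw [e1, e2]
      ring
    · rw [indicator_of_notMem hθ, hw, indicator_of_notMem hθ]
      simp
  have hn : Tendsto (fun n : ℕ => (n : ℝ) / (2 * Real.pi)) atTop atTop :=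
    tendsto_natCast_atTop_atTop.atTop_div_const (by positivity)
  have l1 := (RL.mono_left atTop_le_cocompact).comp hn
  have l2 := (RL.mono_left atBot_le_cocompact).comp (tendsto_neg_atTop_atBot.comp hn)
  have l3 : Tendsto (fun n : ℕ => cosIntegral v n) atTop (nhds 0) := by
    simp only [key]
    simpa using (l1.add l2).div_const 2
  rw [← tendsto_add_atTop_iff_nat 1]
  simp only [chebCoeff_succ]
  simpa using ((tendsto_add_atTop_iff_nat 1).2 l3).const_mul (2 / (Real.pi : ℂ))

/-! ### Convergence of the Chebyshev series, and attainment of the maxima -/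

/-- The Chebyshev series of a continuous function with summable coefficients converges to it. -/
theorem tendsto_chebTrunc {u : ℝ → ℂ} (hu : ContinuousOn u (Icc (-1) 1))
    (hs : Summable (chebCoeff u)) {x : ℝ} (hx : x ∈ Icc (-1 : ℝ) 1) :
    Tendsto (fun N => chebTrunc u N x) atTop (nhds (u x)) := by
  have hpos : Fact (0 < 2 * Real.pi) := ⟨by positivity⟩
  have hcont : Continuous fun θ : ℝ => u (Real.cos θ) :=
    hu.comp_continuous Real.continuous_cos fun θ => ⟨Real.neg_one_le_cos θ, Real.cos_le_one θ⟩
  have hper : Function.Periodic (fun θ : ℝ => u (Real.cos θ)) (2 * Real.pi) := fun θ => by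
    simp
  -- The even function `u ∘ cos` on the circle: its Fourier coefficients at `± n`, `n ≥ 1`, are both
  -- `a_n / 2`, so symmetric Fourier sums are Chebyshev partial sums.
  let F : C(AddCircle (2 * Real.pi), ℂ) := ⟨hper.lift, continuous_coinduced_dom.2 hcont⟩
  have hF : ∀ θ : ℝ, F (θ : AddCircle (2 * Real.pi)) = u (Real.cos θ) := fun θ => hper.lift_coe θ
  have hfour : ∀ (k : ℤ) (θ : ℝ), fourier k (θ : AddCircle (2 * Real.pi)) =
      Complex.exp ((k * θ : ℝ) * Complex.I) := by
    intro k θ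
    rw [fourier_coe_apply]
    congr 1
    have : (Real.pi : ℂ) ≠ 0 := by simp [Real.pi_ne_zero]
    push_cast
    field_simp
  have hcoef : ∀ k : ℤ, fourierCoeff F k = 1 / Real.pi * cosIntegral u k := by
    intro k
    rw [fourierCoeff_eq_intervalIntegral F k (-Real.pi),
      show -Real.pi + 2 * Real.pi = Real.pi by ring]
    simp only [hF, hfour, smul_eq_mul]
    have hc : ∀ j : ℤ, Continuous fun θ : ℝ => Complex.exp ((j * θ : ℝ) * Complex.I) *
        u (Real.cos θ) := fun j => (by fun_prop : Continuous fun θ : ℝ =>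
          Complex.exp ((j * θ : ℝ) * Complex.I)).mul hcont
    rw [← intervalIntegral.integral_add_adjacent_intervals (b := 0)
      ((hc (-k)).intervalIntegrable _ _) ((hc (-k)).intervalIntegrable _ _)]
    have e := intervalIntegral.integral_comp_neg (a := 0) (b := Real.pi) (fun θ : ℝ =>
      Complex.exp (((-k : ℤ) * θ : ℝ) * Complex.I) * u (Real.cos θ))
    rw [neg_zero] at e
    have hc' : Continuous fun θ : ℝ => Complex.exp (((-k : ℤ) * -θ : ℝ) * Complex.I) *
      u (Real.cos (-θ)) := (hc (-k)).comp continuous_neg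
    rw [← e, ← intervalIntegral.integral_add (hc'.intervalIntegrable _ _)
      ((hc (-k)).intervalIntegrable _ _), cosIntegral]
    have e2 : ∀ θ : ℝ, Complex.exp (((-k : ℤ) * -θ : ℝ) * Complex.I) * u (Real.cos (-θ)) +
        Complex.exp (((-k : ℤ) * θ : ℝ) * Complex.I) * u (Real.cos θ) =
        2 * (u (Real.cos θ) * (Real.cos (k * θ) : ℂ)) := by
      intro θ
      rw [Real.cos_neg, Complex.ofReal_cos, Complex.cos]
      push_cast
      simp only [neg_mul, mul_neg, neg_neg]
      ring
    simp only [e2]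
    rw [intervalIntegral.integral_const_mul, Complex.real_smul]
    have : (Real.pi : ℂ) ≠ 0 := by simp [Real.pi_ne_zero]
    push_cast
    field_simp
  have hle : ∀ n : ℕ, ‖fourierCoeff F (n : ℤ)‖ ≤ ‖chebCoeff u n‖ := by
    intro n
    rw [hcoef]
    cases n with
    | zero => rw [chebCoeff_zero]; rfl
    | succ n =>
      rw [chebCoeff_succ, norm_mul, norm_mul]
      push_cast
      gcongr
      simp only [norm_div, norm_one, Complex.norm_ofNat]
      gcongr
      norm_num
  have hsum : Summable fun n : ℕ => fourierCoeff F (n : ℤ) :=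
    Summable.of_norm_bounded hs.norm hle
  have hsum' : Summable (fourierCoeff F) := by
    refine Summable.of_nat_of_neg hsum ?_
    refine hsum.congr fun n => ?_
    rw [hcoef, hcoef, cosIntegral_neg]
  obtain ⟨θ, rfl⟩ : ∃ θ, Real.cos θ = x := ⟨Real.arccos x, Real.cos_arccos hx.1 hx.2⟩
  have hS := (has_pointwise_sum_fourier_series_of_summable hsum' (θ : AddCircle _)).nat_add_neg
  rw [hF] at hS
  have hT := (tendsto_add_atTop_iff_nat 1).2 hS.tendsto_sum_nat
  -- Pairing `k` with `-k` counts the constant term twice; one copy is removed.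
  have hT2 := hT.sub_const (fourierCoeff F 0 • fourier 0 (θ : AddCircle (2 * Real.pi)))
  rw [add_sub_cancel_right] at hT2
  refine hT2.congr fun N => ?_
  induction N with
  | zero =>
    rw [chebTrunc, Finset.sum_range_one, Finset.sum_range_one, hcoef, chebCoeff_zero]
    simp [chebT]
  | succ N ih =>
    rw [chebTrunc_succ, ← ih, Finset.sum_range_succ _ (N + 1), hcoef, hcoef, cosIntegral_neg,
      chebCoeff_succ, chebT_cos, hfour, hfour, Complex.ofReal_cos, Complex.cos]
    push_cast
    simp only [smul_eq_mul, neg_mul, neg_add_rev]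
    ring_nf

theorem isGreatest_maxError {u p : ℝ → ℂ} (hu : ContinuousOn u (Icc (-1) 1))
    (hp : Continuous p) : IsGreatest (errorSet u p) (maxError u p) := by
  have hc : IsCompact (errorSet u p) :=
    isCompact_Icc.image_of_continuousOn (hu.sub hp.continuousOn).norm
  exact hc.isGreatest_sSup ((nonempty_Icc.2 (by norm_num)).image _)

theorem continuous_chebT (n : ℕ) : Continuous (chebT n) := Polynomial.continuous _

theorem continuous_chebTrunc (u : ℝ → ℂ) (N : ℕ) : Continuous (chebTrunc u N) := by
  have := continuous_chebT
  unfold chebTrunc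
  fun_prop

theorem continuous_diffTrunc (u : ℝ → ℂ) (N : ℕ) : Continuous (diffTrunc u N) := by
  have := continuous_chebT
  unfold diffTrunc
  fun_prop

theorem continuous_quadTrunc (u : ℝ → ℂ) (N : ℕ) : Continuous (quadTrunc u N) := by
  have := continuous_chebT
  unfold quadTrunc
  fun_prop

/-! ### Powers of the logarithm -/

theorem slowlyVarying_log_pow (k : ℕ) : SlowlyVarying fun n => Real.log n ^ k := by
  refine ⟨?_, fun ε hε => ?_⟩
  · filter_upwards [eventually_ge_atTop 2] with n hn
    exact pow_pos (Real.log_pos (by exact_mod_cast hn)) k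
  -- Each of the `k` logarithms gets a factor `x ^ (-r)`, and `log x / x ^ r` decreases beyond `exp
  -- (1 / r)`. The spare `r` keeps the quotient meaningful for `k = 0`.
  · set r := ε / (k + 1) with hr
    have hr0 : 0 < r := by positivity
    have hre : ε = r * k + r := by rw [hr]; field_simp
    refine ⟨⌈Real.exp r⁻¹⌉₊ + 1, fun m hm n hn hmn => ?_, fun m hm n hn hmn => ?_⟩
    all_goals
      rw [mem_Ici] at hm hn
      have hm1 : (1 : ℝ) ≤ m := by exact_mod_cast (Nat.le_add_left _ _).trans hm
      have hn1 : (1 : ℝ) ≤ n := by exact_mod_cast (Nat.le_add_left _ _).trans hn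
      have hmn' : (m : ℝ) ≤ n := by exact_mod_cast hmn
      have hm0 : (0 : ℝ) < m := by linarith
      have hn0 : (0 : ℝ) < n := by linarith
      have hlm := Real.log_nonneg hm1
      have hln := Real.log_nonneg hn1
    · simp only
      gcongr
    · have hme : Real.exp r⁻¹ ≤ m := (Nat.le_ceil _).trans (by exact_mod_cast (Nat.le_succ _).trans hm)
      have h1 := Real.log_div_self_rpow_antitoneOn hr0 (mem_Ici.2 hme)
        (mem_Ici.2 (hme.trans hmn')) hmn'
      have e : ∀ x : ℝ, 0 < x → x ^ (-ε) * Real.log x ^ k = (Real.log x / x ^ r) ^ k * x ^ (-r) := by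
        intro x hx
        rw [hre, neg_add, Real.rpow_add hx, Real.rpow_neg hx.le (r * k), Real.rpow_mul_natCast hx.le,
          div_pow]
        field_simp
      simp only
      rw [e _ hm0, e _ hn0]
      have h2 : (n : ℝ) ^ (-r) ≤ (m : ℝ) ^ (-r) :=
        Real.rpow_le_rpow_of_nonpos hm0 hmn' (by linarith)
      simp only at h1
      gcongr

/-- Powers of the logarithm are dominated by negative powers near zero. -/
theorem exists_log_pow_le {ε : ℝ} (hε : 0 < ε) {B : ℝ} (hB : 0 ≤ B) (k : ℕ) :
    ∃ C : ℝ, 0 < C ∧ ∀ t : ℝ, 0 < t → t ≤ 1 → (|Real.log t| + B) ^ k ≤ C * t ^ (-ε) := by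
  set r := ε / (k + 1) with hr
  have hr0 : 0 < r := by positivity
  have hre : ε = r * k + r := by rw [hr]; field_simp
  refine ⟨(1 / r + B) ^ k, by positivity, fun t ht ht1 => ?_⟩
  have h1 := Real.abs_log_mul_self_rpow_lt t r ht ht1 hr0
  have h2 : |Real.log t| ≤ 1 / r * t ^ (-r) := by
    rw [abs_mul, abs_of_pos (Real.rpow_pos_of_pos ht r)] at h1
    rw [Real.rpow_neg ht.le, ← div_eq_mul_inv, le_div_iff₀ (Real.rpow_pos_of_pos ht r)]
    exact h1.le
  have h3 : 1 ≤ t ^ (-r) := Real.one_le_rpow_of_pos_of_le_one_of_nonpos ht ht1 (by linarith)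
  calc (|Real.log t| + B) ^ k ≤ (1 / r * t ^ (-r) + B * t ^ (-r)) ^ k := by
        gcongr
        exact le_mul_of_one_le_right hB h3
    _ = (1 / r + B) ^ k * t ^ (-r * k) := by
        rw [← add_mul, mul_pow, Real.rpow_mul_natCast ht.le]
    _ ≤ _ := by
        gcongr ?_ * ?_
        exact Real.rpow_le_rpow_of_exponent_ge ht ht1 (by linarith)

/-! ### The singular factor on the right half-plane -/

/-- The multivalued factor `w ^ (2 φ) (2 log w) ^ ϑ` of `endpointSingular`, for `w = √(1 - x ^ 2)`,
on the principal branch. -/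
def singularFactor (φ : ℝ) (ϑ : ℕ) (w : ℂ) : ℂ :=
  w ^ ((2 * φ : ℝ) : ℂ) * (2 * Complex.log w) ^ ϑ

theorem singularFactor_zero {φ : ℝ} (hφ : 0 < φ) (ϑ : ℕ) : singularFactor φ ϑ 0 = 0 := by
  rw [singularFactor, Complex.zero_cpow (by exact_mod_cast (by positivity : 2 * φ ≠ 0)), zero_mul]

theorem norm_singularFactor_le (φ : ℝ) (ϑ : ℕ) {w : ℂ} (hw : w ≠ 0) :
    ‖singularFactor φ ϑ w‖ ≤ ‖w‖ ^ (2 * φ) * (2 * (|Real.log ‖w‖| + Real.pi)) ^ ϑ := by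
  have h1 : ‖w ^ ((2 * φ : ℝ) : ℂ)‖ = ‖w‖ ^ (2 * φ) := by
    rw [Complex.norm_cpow_of_ne_zero hw]; simp
  rw [singularFactor, norm_mul, h1, norm_pow, norm_mul, Complex.norm_ofNat]
  gcongr
  calc ‖Complex.log w‖ ≤ |(Complex.log w).re| + |(Complex.log w).im| :=
        Complex.norm_le_abs_re_add_abs_im _
    _ ≤ _ := by
        rw [Complex.log_re, Complex.log_im]
        gcongr
        exact Complex.abs_arg_le_pi w

theorem exists_norm_singularFactor_le (φ : ℝ) (ϑ : ℕ) {ε : ℝ} (hε : 0 < ε) :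
    ∃ C : ℝ, 0 < C ∧ ∀ w : ℂ, w ≠ 0 → ‖w‖ ≤ 1 → ‖singularFactor φ ϑ w‖ ≤ C * ‖w‖ ^ (2 * φ - ε) := by
  obtain ⟨C, hC, h⟩ := exists_log_pow_le hε Real.pi_pos.le ϑ
  refine ⟨2 ^ ϑ * C, by positivity, fun w hw hw1 => ?_⟩
  have hw0 : 0 < ‖w‖ := norm_pos_iff.2 hw
  calc _ ≤ ‖w‖ ^ (2 * φ) * (2 * (|Real.log ‖w‖| + Real.pi)) ^ ϑ := norm_singularFactor_le φ ϑ hw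
    _ = 2 ^ ϑ * (‖w‖ ^ (2 * φ) * (|Real.log ‖w‖| + Real.pi) ^ ϑ) := by rw [mul_pow]; ring
    _ ≤ 2 ^ ϑ * (‖w‖ ^ (2 * φ) * (C * ‖w‖ ^ (-ε))) := by gcongr; exact h _ hw0 hw1
    _ = _ := by rw [sub_eq_add_neg, Real.rpow_add hw0]; ring

theorem differentiableAt_singularFactor (φ : ℝ) (ϑ : ℕ) {w : ℂ} (hw : w ∈ Complex.slitPlane) :
    DifferentiableAt ℂ (singularFactor φ ϑ) w := by
  unfold singularFactor
  exact (differentiableAt_id.cpow_const hw).mul (((Complex.differentiableAt_log hw).const_mul 2).pow ϑ)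

theorem continuousAt_singularFactor_zero {φ : ℝ} (hφ : 0 < φ) (ϑ : ℕ) :
    ContinuousAt (singularFactor φ ϑ) 0 := by
  obtain ⟨C, hC, h⟩ := exists_norm_singularFactor_le φ ϑ hφ
  rw [ContinuousAt, singularFactor_zero hφ]
  refine squeeze_zero_norm' (a := fun w => C * ‖w‖ ^ φ) ?_ ?_
  · filter_upwards [Metric.closedBall_mem_nhds (0 : ℂ) one_pos] with w hw
    rcases eq_or_ne w 0 with rfl | hw0
    · rw [singularFactor_zero hφ, norm_zero]; positivity
    · have := h w hw0 (by simpa using hw)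
      rwa [show 2 * φ - φ = φ by ring] at this
  · have : Continuous fun w : ℂ => C * ‖w‖ ^ φ :=
      continuous_const.mul (continuous_norm.rpow_const fun _ => Or.inr hφ.le)
    simpa [Real.zero_rpow hφ.ne'] using this.tendsto 0

/-- The closed right half-plane meets the cut of the principal logarithm only at `0`, where the
positive power beats the logarithms. -/
theorem continuousAt_singularFactor {φ : ℝ} (hφ : 0 < φ) (ϑ : ℕ) {w : ℂ} (hw : 0 ≤ w.re) :
    ContinuousAt (singularFactor φ ϑ) w := by
  rcases eq_or_ne w 0 with rfl | hw0
  · exact continuousAt_singularFactor_zero hφ ϑ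
  · refine (differentiableAt_singularFactor φ ϑ ?_).continuousAt
    rw [Complex.mem_slitPlane_iff]
    rcases hw.lt_or_eq with h | h
    · exact Or.inl h
    · refine Or.inr fun h' => hw0 (Complex.ext h.symm h')

theorem endpointSingular_eq (φ : ℝ) (ϑ : ℕ) (g : ℂ → ℂ) {x : ℝ}
    (hx : x ∈ Icc (-1 : ℝ) 1) :
    endpointSingular g φ ϑ x = g x * singularFactor φ ϑ (Real.sqrt (1 - x ^ 2) : ℂ) := by
  have h : 0 ≤ 1 - x ^ 2 := by nlinarith [hx.1, hx.2]
  rw [endpointSingular]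
  congr 1
  rw [singularFactor, ← Complex.ofReal_cpow (Real.sqrt_nonneg _),
    ← Complex.ofReal_log (Real.sqrt_nonneg _), Real.log_sqrt h, Real.sqrt_eq_rpow,
    ← Real.rpow_mul h]
  push_cast
  congr 3
  · ring
  · ring

theorem endpointSingular_cos (φ : ℝ) (ϑ : ℕ) (g : ℂ → ℂ) {θ : ℝ}
    (hθ : θ ∈ Icc 0 Real.pi) :
    endpointSingular g φ ϑ (Real.cos θ) =
      g (Real.cos θ : ℂ) * singularFactor φ ϑ (Real.sin θ : ℂ) := by
  rw [endpointSingular_eq φ ϑ g ⟨Real.neg_one_le_cos θ, Real.cos_le_one θ⟩, ← Real.sin_sq,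
    Real.sqrt_sq (Real.sin_nonneg_of_mem_Icc hθ)]

theorem endpointSingular_of_sq_eq_one {φ : ℝ} (hφ : 0 < φ) (ϑ : ℕ) (g : ℂ → ℂ) {x : ℝ}
    (hx : x ^ 2 = 1) : endpointSingular g φ ϑ x = 0 := by
  simp [endpointSingular, hx, Real.zero_rpow hφ.ne']

theorem continuousOn_endpointSingular {φ : ℝ} (hφ : 0 < φ) (ϑ : ℕ) {g : ℂ → ℂ}
    (hg : ContinuousOn g ((fun x : ℝ => (x : ℂ)) '' Icc (-1 : ℝ) 1)) :
    ContinuousOn (endpointSingular g φ ϑ) (Icc (-1) 1) := by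
  refine ContinuousOn.congr (f := fun x : ℝ =>
    g x * singularFactor φ ϑ (Real.sqrt (1 - x ^ 2) : ℂ)) ?_
    fun x hx => endpointSingular_eq φ ϑ g hx
  refine (hg.comp Complex.continuous_ofReal.continuousOn (mapsTo_image _ _)).mul ?_
  refine Continuous.continuousOn (continuous_iff_continuousAt.2 fun x => ?_)
  exact ContinuousAt.comp (g := singularFactor φ ϑ)
    (f := fun x : ℝ => (Real.sqrt (1 - x ^ 2) : ℂ))
    (continuousAt_singularFactor hφ ϑ (by simp [Real.sqrt_nonneg]))
    (by fun_prop)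

/-- Jordan's inequality bounds `sin θ` below by `2 / π` times the distance to the nearer endpoint; a
nonpositive exponent reverses the bound. -/
theorem intervalIntegrable_sin_rpow {s : ℝ} (hs : -1 < s) (hs0 : s ≤ 0) :
    IntervalIntegrable (fun θ => Real.sin θ ^ s) MeasureTheory.volume 0 Real.pi := by
  have h1 : IntervalIntegrable (fun θ : ℝ => θ ^ s) MeasureTheory.volume 0 Real.pi :=
    intervalIntegral.intervalIntegrable_rpow' hs
  have h2 : IntervalIntegrable (fun θ : ℝ => (Real.pi - θ) ^ s) MeasureTheory.volume 0 Real.pi := by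
    simpa using (h1.comp_sub_left Real.pi).symm
  refine ((h1.add h2).const_mul ((2 / Real.pi) ^ s)).mono_fun ?_ ?_
  · exact (Real.measurable_sin.pow_const s).aestronglyMeasurable
  · rw [uIoc_of_le Real.pi_pos.le, ← MeasureTheory.restrict_Ioo_eq_restrict_Ioc]
    filter_upwards [MeasureTheory.ae_restrict_mem measurableSet_Ioo] with θ hθ
    have hp := Real.pi_pos
    have h0 : 0 < θ := hθ.1
    have h0' : 0 < Real.pi - θ := sub_pos.2 hθ.2
    have hsin : 0 < Real.sin θ := Real.sin_pos_of_pos_of_lt_pi hθ.1 hθ.2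
    rw [Real.norm_of_nonneg (by positivity), Real.norm_of_nonneg (by positivity), mul_add,
      ← Real.mul_rpow (by positivity) h0.le, ← Real.mul_rpow (by positivity) h0'.le]
    rcases le_total θ (Real.pi / 2) with h | h
    · have := Real.mul_le_sin h0.le h
      have := Real.rpow_le_rpow_of_nonpos (by positivity) this hs0
      have : 0 ≤ (2 / Real.pi * (Real.pi - θ)) ^ s := by positivity
      linarith
    · have := Real.mul_le_sin h0'.le (by linarith)
      rw [Real.sin_pi_sub] at this
      have := Real.rpow_le_rpow_of_nonpos (by positivity) this hs0
      have : 0 ≤ (2 / Real.pi * θ) ^ s := by positivity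
      linarith

theorem intervalIntegrable_div_sin_sq {φ : ℝ} (hφ : 1 / 2 < φ) (ϑ : ℕ) {g : ℂ → ℂ}
    (hg : ContinuousOn g ((fun x : ℝ => (x : ℂ)) '' Icc (-1 : ℝ) 1)) :
    IntervalIntegrable (fun θ => endpointSingular g φ ϑ (Real.cos θ) /
      ((1 - Real.cos θ ^ 2 : ℝ) : ℂ)) MeasureTheory.volume 0 Real.pi := by
  have hφ0 : 0 < φ := by linarith
  have hu := continuousOn_endpointSingular hφ0 ϑ hg
  have hgc := hg.comp Complex.continuous_ofReal.continuousOn (mapsTo_image _ _)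
  obtain ⟨B, hB⟩ := isCompact_Icc.exists_bound_of_continuousOn hgc
  have hB0 : 0 ≤ B := (norm_nonneg _).trans (hB 0 (by norm_num))
  obtain ⟨C, hC, h⟩ := exists_norm_singularFactor_le φ ϑ (show 0 < φ - 1 / 2 by linarith)
  -- Giving up `φ - 1/2` for the logarithms leaves `2φ - (φ - 1/2) - 2 = φ - 3/2`, which exceeds
  -- `-1` exactly when `φ > 1/2`.
  have hs1 : -1 < min (φ - 3 / 2) 0 := lt_min (by linarith) (by norm_num)
  refine ((intervalIntegrable_sin_rpow hs1 (min_le_right _ _)).const_mul (B * C)).mono_fun ?_ ?_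
  · have hcont : Continuous fun θ : ℝ => endpointSingular g φ ϑ (Real.cos θ) :=
      hu.comp_continuous Real.continuous_cos fun θ => ⟨Real.neg_one_le_cos θ, Real.cos_le_one θ⟩
    have hden : Measurable fun θ : ℝ => ((1 - Real.cos θ ^ 2 : ℝ) : ℂ) :=
      (by fun_prop : Continuous fun θ : ℝ => ((1 - Real.cos θ ^ 2 : ℝ) : ℂ)).measurable
    exact (hcont.measurable.div hden).aestronglyMeasurable
  · rw [uIoc_of_le Real.pi_pos.le, ← MeasureTheory.restrict_Ioo_eq_restrict_Ioc]
    filter_upwards [MeasureTheory.ae_restrict_mem measurableSet_Ioo] with θ hθ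
    have hsin : 0 < Real.sin θ := Real.sin_pos_of_pos_of_lt_pi hθ.1 hθ.2
    have hw := h (Real.sin θ : ℂ) (by exact_mod_cast hsin.ne')
      (by rw [Complex.norm_real, Real.norm_of_nonneg hsin.le]; exact Real.sin_le_one θ)
    rw [Complex.norm_real, Real.norm_of_nonneg hsin.le] at hw
    have hb := hB (Real.cos θ) ⟨Real.neg_one_le_cos θ, Real.cos_le_one θ⟩
    rw [endpointSingular_cos φ ϑ g (Ioo_subset_Icc_self hθ), ← Real.sin_sq, norm_div, norm_mul,
      Complex.norm_real, Real.norm_of_nonneg (by positivity), Real.norm_of_nonneg (by positivity),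
      div_le_iff₀ (by positivity)]
    have e1 : Real.sin θ ^ (2 * φ - (φ - 1 / 2)) = Real.sin θ ^ (φ - 3 / 2) * Real.sin θ ^ 2 := by
      rw [← Real.rpow_natCast, ← Real.rpow_add hsin]
      congr 1
      push_cast
      ring
    have e2 : Real.sin θ ^ (φ - 3 / 2) ≤ Real.sin θ ^ min (φ - 3 / 2) 0 :=
      Real.rpow_le_rpow_of_exponent_ge hsin (Real.sin_le_one θ) (min_le_left _ _)
    calc _ ≤ B * (C * (Real.sin θ ^ min (φ - 3 / 2) 0 * Real.sin θ ^ 2)) := by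
          refine mul_le_mul hb (hw.trans ?_) (norm_nonneg _) hB0
          rw [e1]
          gcongr
      _ = _ := by ring

theorem endpointSingular_quad {φ : ℝ} (hφ : 1 / 2 < φ) (ϑ : ℕ) {g : ℂ → ℂ}
    (hg : ContinuousOn g ((fun x : ℝ => (x : ℂ)) '' Icc (-1 : ℝ) 1)) :
    QuadRelations (chebCoeff (endpointSingular g φ ϑ)) (quadCoeff (endpointSingular g φ ϑ)) ∧
      Tendsto (quadCoeff (endpointSingular g φ ϑ)) atTop (nhds 0) := by
  have hi := intervalIntegrable_div_sin_sq hφ ϑ hg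
  refine ⟨quadRelations_of_cosIntegral fun k => cosIntegral_eq_of_mul_sin_sq (fun θ hθ => ?_) hi k,
    tendsto_chebCoeff_zero hi⟩
  have hsin : 0 < Real.sin θ := Real.sin_pos_of_pos_of_lt_pi hθ.1 hθ.2
  rw [← Real.sin_sq, div_mul_cancel₀]
  exact_mod_cast (by positivity : Real.sin θ ^ 2 ≠ 0)

/-! ### Laplace integrals with logarithms -/

theorem integrableOn_rpow_mul_log_pow_mul_exp {p : ℝ} (hp : 0 < p) (k : ℕ) :
    MeasureTheory.IntegrableOn (fun t : ℝ => t ^ p * (|Real.log t| + 3) ^ k * Real.exp (-t))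
      (Ioi 0) := by
  obtain ⟨C, hC, h⟩ := exists_log_pow_le hp (show (0 : ℝ) ≤ 3 by norm_num) k
  have i1 : MeasureTheory.IntegrableOn (fun t : ℝ => C * Real.exp (-t)) (Ioi 0) :=
    (integrableOn_exp_neg_Ioi 0).const_mul C
  have i2 : MeasureTheory.IntegrableOn
      (fun t : ℝ => 3 ^ k * (Real.exp (-t) * t ^ (p + k + 1 - 1))) (Ioi 0) :=
    (Real.GammaIntegral_convergent (by positivity)).const_mul _
  refine MeasureTheory.Integrable.mono' (i1.add i2) ?_ ?_
  · have : Measurable fun t : ℝ => t ^ p * (|Real.log t| + 3) ^ k * Real.exp (-t) := by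
      have := Real.measurable_log
      fun_prop
    exact this.aestronglyMeasurable
  · filter_upwards [MeasureTheory.ae_restrict_mem measurableSet_Ioi] with t ht
    have ht0 : 0 < t := ht
    rw [Real.norm_of_nonneg (by positivity)]
    simp only [Pi.add_apply, add_sub_cancel_right]
    rcases le_total t 1 with h1 | h1
    · have e : t ^ p * (|Real.log t| + 3) ^ k ≤ C := by
        calc _ ≤ t ^ p * (C * t ^ (-p)) := by gcongr; exact h t ht0 h1
          _ = C := by rw [Real.rpow_neg ht0.le]; field_simp
      have : 0 ≤ 3 ^ k * (Real.exp (-t) * t ^ (p + k)) := by positivity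
      have : t ^ p * (|Real.log t| + 3) ^ k * Real.exp (-t) ≤ C * Real.exp (-t) := by gcongr
      linarith
    · have e : |Real.log t| + 3 ≤ 3 * t := by
        rw [abs_of_nonneg (Real.log_nonneg h1)]
        linarith [Real.log_le_sub_one_of_pos ht0]
      have : 0 ≤ C * Real.exp (-t) := by positivity
      have : t ^ p * (|Real.log t| + 3) ^ k * Real.exp (-t) ≤
          3 ^ k * (Real.exp (-t) * t ^ (p + k)) := by
        calc _ ≤ t ^ p * (3 * t) ^ k * Real.exp (-t) := by gcongr
          _ = _ := by rw [Real.rpow_add ht0, Real.rpow_natCast, mul_pow]; ring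
      linarith

/-- A Laplace-type bound: the integral of `t ^ p * |log t| ^ k * exp (-n t)` is
`O(log ^ k n / n ^ (p + 1))`. -/
theorem exists_laplace_le {p : ℝ} (hp : 0 < p) (k : ℕ) :
    ∃ C : ℝ, 0 ≤ C ∧ ∀ n : ℕ, 3 ≤ n →
      MeasureTheory.IntegrableOn
        (fun t : ℝ => t ^ p * (|Real.log t| + 2) ^ k * Real.exp (-(n * t))) (Ioi 0) ∧
      ∫ t in Ioi (0 : ℝ), t ^ p * (|Real.log t| + 2) ^ k * Real.exp (-(n * t)) ≤
        C * (Real.log n ^ k / (n : ℝ) ^ (p + 1)) := by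
  set H : ℝ → ℝ := fun t => t ^ p * (|Real.log t| + 3) ^ k * Real.exp (-t) with hH
  have hHi : MeasureTheory.IntegrableOn H (Ioi 0) := integrableOn_rpow_mul_log_pow_mul_exp hp k
  have hH0 : ∀ t, 0 < t → 0 ≤ H t := fun t ht => by positivity
  refine ⟨∫ t in Ioi 0, H t, MeasureTheory.setIntegral_nonneg measurableSet_Ioi hH0,
    fun n hn => ?_⟩
  have hn3 : (3 : ℝ) ≤ n := by exact_mod_cast hn
  have hn0 : (0 : ℝ) < n := by linarith
  have hlog : 1 ≤ Real.log n := by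
    rw [Real.le_log_iff_exp_le hn0]
    linarith [Real.exp_one_lt_three]
  have hHn : MeasureTheory.IntegrableOn (fun t : ℝ => H (n * t)) (Ioi 0) := by
    have := (MeasureTheory.integrableOn_Ioi_comp_mul_left_iff H 0 hn0).2 (by simpa using hHi)
    exact this
  have hle : ∀ t : ℝ, 0 < t → t ^ p * (|Real.log t| + 2) ^ k * Real.exp (-(n * t)) ≤
      Real.log n ^ k / (n : ℝ) ^ p * H (n * t) := by
    intro t ht
    have e1 : Real.log t = Real.log (n * t) - Real.log n := by
      rw [Real.log_mul hn0.ne' ht.ne']; ring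
    -- Rescaling by `n` turns each logarithm into at most one factor `log n`; this uses `log n ≥ 1`,
    -- hence `n ≥ 3`.
    have e2 : |Real.log t| + 2 ≤ Real.log n * (|Real.log (n * t)| + 3) := by
      have : |Real.log t| ≤ |Real.log (n * t)| + Real.log n := by
        rw [e1]
        refine (abs_sub _ _).trans ?_
        rw [abs_of_nonneg (by linarith : 0 ≤ Real.log n)]
      nlinarith [abs_nonneg (Real.log (n * t))]
    calc _ ≤ t ^ p * (Real.log n * (|Real.log (n * t)| + 3)) ^ k * Real.exp (-(n * t)) := by gcongr
      _ = _ := by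
        rw [hH]
        simp only
        rw [Real.mul_rpow hn0.le ht.le, mul_pow]
        field_simp
  have hi := hHn.const_mul (Real.log n ^ k / (n : ℝ) ^ p)
  have hint : MeasureTheory.IntegrableOn
      (fun t : ℝ => t ^ p * (|Real.log t| + 2) ^ k * Real.exp (-(n * t))) (Ioi 0) := by
    refine MeasureTheory.Integrable.mono' hi ?_ ?_
    · have : Measurable fun t : ℝ =>
          t ^ p * (|Real.log t| + 2) ^ k * Real.exp (-(n * t)) := by
        have := Real.measurable_log
        fun_prop
      exact this.aestronglyMeasurable
    · filter_upwards [MeasureTheory.ae_restrict_mem measurableSet_Ioi] with t ht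
      have ht0 : 0 < t := ht
      rw [Real.norm_of_nonneg (by positivity)]
      exact hle t ht
  refine ⟨hint, ?_⟩
  calc _ ≤ ∫ t in Ioi 0, Real.log n ^ k / (n : ℝ) ^ p * H (n * t) :=
        MeasureTheory.setIntegral_mono_on hint hi measurableSet_Ioi hle
    _ = Real.log n ^ k / (n : ℝ) ^ p * ((n : ℝ)⁻¹ * ∫ t in Ioi 0, H t) := by
        rw [MeasureTheory.integral_const_mul, MeasureTheory.integral_comp_mul_left_Ioi H 0 hn0,
          mul_zero, smul_eq_mul]
    _ = _ := by
        rw [Real.rpow_add hn0, Real.rpow_one]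
        field_simp

theorem sinh_le_two_mul {t : ℝ} (h0 : 0 ≤ t) (h1 : t ≤ 1) : Real.sinh t ≤ 2 * t := by
  have := Real.abs_exp_sub_one_le (x := t) (by rwa [abs_of_nonneg h0])
  rw [abs_of_nonneg h0] at this
  have := (abs_le.1 this).2
  have := Real.add_one_le_exp (-t)
  rw [Real.sinh_eq]
  linarith

/-! ### The jump across the imaginary axis -/

open Classical in
/-- The exponent of the logarithm in `logFactor`. -/
def logExponent (φ : ℝ) (ϑ : ℕ) : ℕ := if ∃ m : ℤ, φ = m then ϑ - 1 else ϑ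

/-- The jump of `singularFactor` across the imaginary axis. Its leading logarithm cancels if `φ`
is an integer. -/
theorem exists_norm_singularFactor_sub_le (φ : ℝ) (ϑ : ℕ) :
    ∃ C : ℝ, 0 ≤ C ∧ ∀ s : ℝ, 0 < s →
      ‖singularFactor φ ϑ (s * Complex.I) - singularFactor φ ϑ (-(s * Complex.I))‖ ≤
        C * (s ^ (2 * φ) * (|Real.log s| + 1) ^ logExponent φ ϑ) := by
  have hπ : (0 : ℝ) < Real.pi := Real.pi_pos
  have hlog1 : ∀ s : ℝ, 0 < s → Complex.log (s * Complex.I) =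
      Real.log s + Real.pi / 2 * Complex.I := fun s hs => by
    rw [Complex.log_ofReal_mul hs Complex.I_ne_zero, Complex.log_I]
  have hlog2 : ∀ s : ℝ, 0 < s → Complex.log (-(s * Complex.I)) =
      Real.log s - Real.pi / 2 * Complex.I := fun s hs => by
    rw [← mul_neg, Complex.log_ofReal_mul hs (neg_ne_zero.2 Complex.I_ne_zero), Complex.log_neg_I]
    ring
  set e₁ : ℂ := Complex.exp (Real.pi * φ * Complex.I) with he₁
  set e₂ : ℂ := Complex.exp (-(Real.pi * φ * Complex.I)) with he₂
  have hn₁ : ‖e₁‖ = 1 := by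
    rw [he₁]; exact_mod_cast Complex.norm_exp_ofReal_mul_I (Real.pi * φ)
  have hn₂ : ‖e₂‖ = 1 := by
    have := Complex.norm_exp_ofReal_mul_I (-(Real.pi * φ))
    rw [he₂]; rw [← this]; push_cast; ring_nf
  set X : ℝ → ℂ := fun s => 2 * Real.log s + Real.pi * Complex.I with hX
  set Y : ℝ → ℂ := fun s => 2 * Real.log s - Real.pi * Complex.I with hY
  have hπ4 : Real.pi ≤ 4 := Real.pi_le_four
  have hXn : ∀ s, ‖X s‖ ≤ 4 * (|Real.log s| + 1) := fun s => by
    refine (norm_add_le _ _).trans ?_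
    simp only [norm_mul, Complex.norm_ofNat, Complex.norm_real, Complex.norm_I, Real.norm_eq_abs,
      abs_of_pos hπ]
    linarith [abs_nonneg (Real.log s)]
  have hYn : ∀ s, ‖Y s‖ ≤ 4 * (|Real.log s| + 1) := fun s => by
    refine (norm_sub_le _ _).trans ?_
    simp only [norm_mul, Complex.norm_ofNat, Complex.norm_real, Complex.norm_I, Real.norm_eq_abs,
      abs_of_pos hπ]
    linarith [abs_nonneg (Real.log s)]
  have hrep : ∀ s : ℝ, 0 < s →
      singularFactor φ ϑ (s * Complex.I) - singularFactor φ ϑ (-(s * Complex.I)) =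
        ((s ^ (2 * φ) : ℝ) : ℂ) * (e₁ * X s ^ ϑ - e₂ * Y s ^ ϑ) := by
    intro s hs
    have hsI : (s : ℂ) * Complex.I ≠ 0 :=
      mul_ne_zero (by exact_mod_cast hs.ne') Complex.I_ne_zero
    rw [singularFactor, singularFactor, Complex.cpow_def_of_ne_zero hsI,
      Complex.cpow_def_of_ne_zero (neg_ne_zero.2 hsI), hlog1 s hs, hlog2 s hs,
      Real.rpow_def_of_pos hs, Complex.ofReal_exp]
    have x₁ : Complex.exp ((Real.log s + Real.pi / 2 * Complex.I) * ((2 * φ : ℝ) : ℂ)) =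
        Complex.exp ((Real.log s * (2 * φ) : ℝ) : ℂ) * e₁ := by
      rw [he₁, ← Complex.exp_add]
      congr 1; push_cast; ring
    have x₂ : Complex.exp ((Real.log s - Real.pi / 2 * Complex.I) * ((2 * φ : ℝ) : ℂ)) =
        Complex.exp ((Real.log s * (2 * φ) : ℝ) : ℂ) * e₂ := by
      rw [he₂, ← Complex.exp_add]
      congr 1; push_cast; ring
    have y₁ : 2 * (Real.log s + Real.pi / 2 * Complex.I) = X s := by simp only [hX]; ring
    have y₂ : 2 * (Real.log s - Real.pi / 2 * Complex.I) = Y s := by simp only [hY]; ring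
    rw [x₁, x₂, y₁, y₂]
    ring
  suffices hmain : ∃ C : ℝ, 0 ≤ C ∧ ∀ s : ℝ, 0 < s → ‖e₁ * X s ^ ϑ - e₂ * Y s ^ ϑ‖ ≤
      C * (|Real.log s| + 1) ^ logExponent φ ϑ by
    obtain ⟨C, hC, h⟩ := hmain
    refine ⟨C, hC, fun s hs => ?_⟩
    have hp : 0 < s ^ (2 * φ) := Real.rpow_pos_of_pos hs _
    rw [hrep s hs, norm_mul, Complex.norm_real, Real.norm_of_nonneg hp.le]
    calc _ ≤ s ^ (2 * φ) * (C * (|Real.log s| + 1) ^ logExponent φ ϑ) := by gcongr; exact h s hs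
      _ = _ := by ring
  by_cases hφ : ∃ m : ℤ, φ = m
  · have hk : logExponent φ ϑ = ϑ - 1 := if_pos hφ
    have he : e₂ = e₁ := by
      obtain ⟨m, hm⟩ := hφ
      rw [he₁, he₂, Complex.exp_eq_exp_iff_exists_int]
      refine ⟨-m, ?_⟩
      rw [hm]
      push_cast
      ring
    refine ⟨ϑ * 4 ^ (ϑ - 1) * (2 * Real.pi), by positivity, fun s _ => ?_⟩
    -- With equal phases the jump is a multiple of `X ^ ϑ - Y ^ ϑ`. The factor `X - Y = 2π i` is
    -- free of logarithms, so one power is saved; for `ϑ = 0` the cofactor is an empty sum and the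
    -- jump vanishes.
    rw [he, ← mul_sub, norm_mul, hn₁, one_mul, ← (Commute.all (X s) (Y s)).geom_sum₂_mul, norm_mul, hk]
    have hXY : ‖X s - Y s‖ = 2 * Real.pi := by
      have : X s - Y s = ((2 * Real.pi : ℝ) : ℂ) * Complex.I := by
        simp only [hX, hY]; push_cast; ring
      rw [this, norm_mul, Complex.norm_I, mul_one, Complex.norm_real,
        Real.norm_of_nonneg (by positivity)]
    rw [hXY]
    have hsum : ‖∑ i ∈ Finset.range ϑ, X s ^ i * Y s ^ (ϑ - 1 - i)‖ ≤
        ϑ * (4 * (|Real.log s| + 1)) ^ (ϑ - 1) := by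
      refine (norm_sum_le_of_le (f := fun i => X s ^ i * Y s ^ (ϑ - 1 - i)) _
        (n := fun _ => (4 * (|Real.log s| + 1)) ^ (ϑ - 1)) fun i hi => ?_).trans ?_
      · have hi' : i < ϑ := Finset.mem_range.1 hi
        rw [norm_mul, norm_pow, norm_pow]
        calc _ ≤ (4 * (|Real.log s| + 1)) ^ i * (4 * (|Real.log s| + 1)) ^ (ϑ - 1 - i) := by
              gcongr
              · exact hXn s
              · exact hYn s
          _ = _ := by rw [← pow_add]; congr 1; omega
      · simp
    calc _ ≤ ϑ * (4 * (|Real.log s| + 1)) ^ (ϑ - 1) * (2 * Real.pi) := by gcongr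
      _ = _ := by rw [mul_pow]; ring
  · have hk : logExponent φ ϑ = ϑ := if_neg hφ
    refine ⟨2 * 4 ^ ϑ, by positivity, fun s _ => ?_⟩
    rw [hk]
    have h1 : ‖e₁ * X s ^ ϑ‖ ≤ (4 * (|Real.log s| + 1)) ^ ϑ := by
      rw [norm_mul, hn₁, one_mul, norm_pow]; gcongr; exact hXn s
    have h2 : ‖e₂ * Y s ^ ϑ‖ ≤ (4 * (|Real.log s| + 1)) ^ ϑ := by
      rw [norm_mul, hn₂, one_mul, norm_pow]; gcongr; exact hYn s
    refine (norm_sub_le_of_le h1 h2).trans (le_of_eq ?_)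
    rw [mul_pow]; ring

/-! ### Contour shift in the strip -/

/-- Analyticity on `[-1, 1]` gives analyticity of `g ∘ cos` on a strip around `[0, π]`. -/
theorem exists_strip {g : ℂ → ℂ}
    (hg : AnalyticOnNhd ℂ g ((fun x : ℝ => (x : ℂ)) '' Icc (-1 : ℝ) 1)) :
    ∃ L : ℝ, 0 < L ∧ L ≤ 1 ∧ ∀ z : ℂ, z.re ∈ Icc 0 Real.pi → |z.im| ≤ L →
      AnalyticAt ℂ g (Complex.cos z) := by
  set U : Set (ℝ × ℝ) :=
    (fun q : ℝ × ℝ => Complex.cos (q.1 + q.2 * Complex.I)) ⁻¹' {z | AnalyticAt ℂ g z} with hU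
  have hUo : IsOpen U := (isOpen_analyticAt ℂ g).preimage (by fun_prop)
  have hsub : Icc 0 Real.pi ×ˢ {(0 : ℝ)} ⊆ U := by
    rintro ⟨x, y⟩ ⟨-, hy⟩
    have hy' : y = 0 := hy
    simp only [hU, mem_preimage, mem_ofPred_eq, hy', Complex.ofReal_zero, zero_mul, add_zero]
    rw [← Complex.ofReal_cos]
    exact hg _ ⟨_, ⟨Real.neg_one_le_cos x, Real.cos_le_one x⟩, rfl⟩
  obtain ⟨u, v, -, hv, hu, h0, huv⟩ :=
    generalized_tube_lemma (isCompact_Icc (a := (0:ℝ)) (b := Real.pi)) isCompact_singleton hUo hsub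
  obtain ⟨r, hr, hball⟩ := Metric.isOpen_iff.1 hv 0 (h0 rfl)
  refine ⟨min (r / 2) 1, lt_min (by linarith) one_pos, min_le_right _ _, fun z hz hz' => ?_⟩
  have hmem : ((z.re, z.im) : ℝ × ℝ) ∈ U := by
    refine huv ⟨hu hz, hball ?_⟩
    rw [Metric.mem_ball, dist_zero_right, Real.norm_eq_abs]
    have := hz'.trans (min_le_left _ _)
    linarith
  simpa only [hU, mem_preimage, mem_ofPred_eq, Complex.re_add_im] using hmem

theorem sin_re (z : ℂ) : (Complex.sin z).re = Real.sin z.re * Real.cosh z.im := by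
  rw [Complex.sin_eq]
  simp [← Complex.ofReal_sin, ← Complex.ofReal_cos, ← Complex.ofReal_cosh, ← Complex.ofReal_sinh]

/-- The analytic continuation of `θ ↦ endpointSingular g φ ϑ (cos θ)` to a strip. -/
def stripExtension (g : ℂ → ℂ) (φ : ℝ) (ϑ : ℕ) (z : ℂ) : ℂ :=
  g (Complex.cos z) * singularFactor φ ϑ (Complex.sin z)

theorem continuousAt_stripExtension {g : ℂ → ℂ} {φ : ℝ} (hφ : 0 < φ) (ϑ : ℕ) {z : ℂ}
    (hg : AnalyticAt ℂ g (Complex.cos z)) (hz : z.re ∈ Icc 0 Real.pi) :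
    ContinuousAt (stripExtension g φ ϑ) z := by
  have h : 0 ≤ (Complex.sin z).re := by
    rw [sin_re]
    exact mul_nonneg (Real.sin_nonneg_of_mem_Icc hz) (Real.cosh_pos _).le
  exact (hg.continuousAt.comp Complex.continuous_cos.continuousAt).mul
    (ContinuousAt.comp (continuousAt_singularFactor hφ ϑ h) Complex.continuous_sin.continuousAt)

theorem differentiableAt_stripExtension {g : ℂ → ℂ} (φ : ℝ) (ϑ : ℕ) {z : ℂ}
    (hg : AnalyticAt ℂ g (Complex.cos z)) (hz : z.re ∈ Ioo 0 Real.pi) :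
    DifferentiableAt ℂ (stripExtension g φ ϑ) z := by
  have h : 0 < (Complex.sin z).re := by
    rw [sin_re]
    exact mul_pos (Real.sin_pos_of_mem_Ioo hz) (Real.cosh_pos _)
  exact (hg.differentiableAt.comp z Complex.differentiable_cos.differentiableAt).mul
    ((differentiableAt_singularFactor φ ϑ (Or.inl h)).comp z
      Complex.differentiable_sin.differentiableAt)

/-- Cauchy's theorem on the rectangle with vertices `0`, `π`, `π + i σ L`, `i σ L`. -/
theorem integral_stripExtension_mul_exp {g : ℂ → ℂ} {φ : ℝ} (hφ : 0 < φ) (ϑ : ℕ) {L : ℝ}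
    (hL : 0 < L)
    (hg : ∀ z : ℂ, z.re ∈ Icc 0 Real.pi → |z.im| ≤ L → AnalyticAt ℂ g (Complex.cos z))
    {σ : ℝ} (hσ : |σ| = 1) (n : ℕ) :
    ∫ x in (0 : ℝ)..Real.pi, stripExtension g φ ϑ x * Complex.exp (σ * n * x * Complex.I) =
      (∫ x in (0 : ℝ)..Real.pi, stripExtension g φ ϑ (x + (σ * L : ℝ) * Complex.I) *
        Complex.exp (σ * n * (x + (σ * L : ℝ) * Complex.I) * Complex.I)) +
      Complex.I * σ * ∫ t in (0 : ℝ)..L, (g (Complex.cosh t) *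
          singularFactor φ ϑ (σ * (Complex.sinh t * Complex.I)) -
        (-1) ^ n * g (-Complex.cosh t) * singularFactor φ ϑ (-(σ * (Complex.sinh t * Complex.I)))) *
          Complex.exp (-(n * t)) := by
  set Φ : ℂ → ℂ := fun z => stripExtension g φ ϑ z * Complex.exp (σ * n * z * Complex.I) with hΦ
  have hσ2 : σ * σ = 1 := by
    rcases eq_or_eq_neg_of_abs_eq hσ with h | h <;> rw [h] <;> norm_num
  have hσ2' : (σ : ℂ) * σ = 1 := by exact_mod_cast hσ2
  have him : ∀ y ∈ uIcc 0 (σ * L), |y| ≤ L := fun y hy => by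
    rcases eq_or_eq_neg_of_abs_eq hσ with h | h
    · rw [h, one_mul, uIcc_of_le hL.le] at hy
      exact abs_le.2 ⟨by linarith [hy.1], hy.2⟩
    · rw [h, neg_one_mul, uIcc_of_ge (by linarith)] at hy
      exact abs_le.2 ⟨hy.1, by linarith [hy.2]⟩
  have hexp : Continuous fun z : ℂ => Complex.exp (σ * n * z * Complex.I) := by fun_prop
  have hΦc : ∀ z : ℂ, z.re ∈ Icc 0 Real.pi → |z.im| ≤ L → ContinuousAt Φ z := fun z h1 h2 =>
    (continuousAt_stripExtension hφ ϑ (hg z h1 h2) h1).mul hexp.continuousAt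
  have hΦd : ∀ z : ℂ, z.re ∈ Ioo 0 Real.pi → |z.im| ≤ L → DifferentiableAt ℂ Φ z := fun z h1 h2 =>
    (differentiableAt_stripExtension φ ϑ (hg z (Ioo_subset_Icc_self h1) h2) h1).mul (by fun_prop)
  -- The branch points `0` and `π` are corners of the rectangle: continuity up to the boundary with
  -- holomorphy inside suffices.
  have cauchy := Complex.integral_boundary_rect_eq_zero_of_continuousOn_of_differentiableOn Φ 0
    (Real.pi + (σ * L : ℝ) * Complex.I) (fun z hz => ?_) (fun z hz => ?_)
  · have side : ∀ t : ℝ, Φ ((0 : ℝ) + ((σ * t : ℝ) : ℂ) * Complex.I) -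
        Φ ((Real.pi : ℂ) + ((σ * t : ℝ) : ℂ) * Complex.I) = (g (Complex.cosh t) *
          singularFactor φ ϑ (σ * (Complex.sinh t * Complex.I)) -
        (-1) ^ n * g (-Complex.cosh t) *
          singularFactor φ ϑ (-(σ * (Complex.sinh t * Complex.I)))) *
          Complex.exp (-(n * t)) := by
      intro t
      have ec : Complex.cos (((σ * t : ℝ) : ℂ) * Complex.I) = Complex.cosh t := by
        rw [Complex.cos_mul_I]
        rcases eq_or_eq_neg_of_abs_eq hσ with h | h <;> rw [h] <;> simp
      have es : Complex.sin (((σ * t : ℝ) : ℂ) * Complex.I) =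
          σ * (Complex.sinh t * Complex.I) := by
        rw [Complex.sin_mul_I]
        rcases eq_or_eq_neg_of_abs_eq hσ with h | h <;> rw [h] <;> simp
      have ee : Complex.exp (σ * n * (((σ * t : ℝ) : ℂ) * Complex.I) * Complex.I) =
          Complex.exp (-(n * t)) := by
        congr 1
        push_cast
        linear_combination (n * t * Complex.I * Complex.I : ℂ) * hσ2' + (n * t : ℂ) * Complex.I_mul_I
      have ep : Complex.exp (σ * n * Real.pi * Complex.I) = (-1) ^ n := by
        rw [← Complex.exp_pi_mul_I]
        rcases eq_or_eq_neg_of_abs_eq hσ with h | h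
        · rw [← Complex.exp_nat_mul, h]; congr 1; push_cast; ring
        · rw [← Complex.exp_nat_mul, h, Complex.exp_eq_exp_iff_exists_int]
          exact ⟨-n, by push_cast; ring⟩
      simp only [hΦ, stripExtension, Complex.ofReal_zero, zero_add]
      rw [add_comm (Real.pi : ℂ), Complex.cos_add_pi, Complex.sin_add_pi, mul_add, add_mul,
        Complex.exp_add, ec, es, ee, ep]
      ring
    have hcont : ∀ x ∈ Icc 0 Real.pi, IntervalIntegrable
        (fun t : ℝ => Φ ((x : ℂ) + ((σ * t : ℝ) : ℂ) * Complex.I)) MeasureTheory.volume 0 L := by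
      intro x hx
      refine ContinuousOn.intervalIntegrable fun t ht => ContinuousAt.continuousWithinAt ?_
      rw [uIcc_of_le hL.le] at ht
      refine ContinuousAt.comp (g := Φ)
        (f := fun t : ℝ => (x : ℂ) + ((σ * t : ℝ) : ℂ) * Complex.I)
        (hΦc _ (by simpa using hx) ?_) (by fun_prop)
      simp only [Complex.add_im, Complex.ofReal_im, Complex.mul_im, Complex.ofReal_re,
        Complex.I_im, Complex.I_re, mul_one, mul_zero, add_zero, zero_add]
      rw [abs_mul, hσ, one_mul, abs_of_nonneg ht.1]
      exact ht.2
    have sub : ∀ x : ℝ, ∫ y in (0 : ℝ)..σ * L, Φ ((x : ℂ) + y * Complex.I) =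
        σ * ∫ t in (0 : ℝ)..L, Φ ((x : ℂ) + ((σ * t : ℝ) : ℂ) * Complex.I) := by
      intro x
      have := intervalIntegral.smul_integral_comp_mul_left (a := 0) (b := L)
        (fun y : ℝ => Φ ((x : ℂ) + y * Complex.I)) σ
      rw [mul_zero] at this
      rw [← this, Complex.real_smul]
    simp only [Complex.zero_re, Complex.zero_im, Complex.add_re, Complex.add_im, Complex.ofReal_re,
      Complex.ofReal_im, Complex.mul_re, Complex.mul_im, Complex.I_re, Complex.I_im, mul_zero,
      mul_one, sub_self, add_zero, zero_add, smul_eq_mul] at cauchy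
    rw [sub, sub] at cauchy
    simp only [← side]
    rw [intervalIntegral.integral_sub (hcont 0 ⟨le_rfl, Real.pi_pos.le⟩)
      (hcont Real.pi ⟨Real.pi_pos.le, le_rfl⟩)]
    simp only [Complex.ofReal_zero, zero_mul, add_zero] at cauchy ⊢
    linear_combination cauchy
  · simp only [Complex.zero_re, Complex.zero_im, Complex.add_re, Complex.add_im, Complex.ofReal_re,
      Complex.ofReal_im, Complex.mul_re, Complex.mul_im, Complex.I_re, Complex.I_im, mul_zero,
      mul_one, sub_self, add_zero, zero_add, Complex.mem_reProdIm] at hz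
    rw [uIcc_of_le Real.pi_pos.le] at hz
    exact (hΦc z hz.1 (him _ hz.2)).continuousWithinAt
  · simp only [Complex.zero_re, Complex.zero_im, Complex.add_re, Complex.add_im, Complex.ofReal_re,
      Complex.ofReal_im, Complex.mul_re, Complex.mul_im, Complex.I_re, Complex.I_im, mul_zero,
      mul_one, sub_self, add_zero, zero_add, Complex.mem_reProdIm] at hz
    rw [min_eq_left Real.pi_pos.le, max_eq_right Real.pi_pos.le] at hz
    exact (hΦd z hz.1 (him _ (Ioo_subset_Icc_self hz.2))).differentiableWithinAt

/-- Adding the two contour integrals leaves the jump of `singularFactor` across the imaginary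
axis. -/
theorem two_mul_cosIntegral_endpointSingular {g : ℂ → ℂ} {φ : ℝ} (hφ : 0 < φ) (ϑ : ℕ) {L : ℝ}
    (hL : 0 < L)
    (hg : ∀ z : ℂ, z.re ∈ Icc 0 Real.pi → |z.im| ≤ L → AnalyticAt ℂ g (Complex.cos z)) (n : ℕ) :
    2 * cosIntegral (endpointSingular g φ ϑ) n =
      (∫ x in (0 : ℝ)..Real.pi, stripExtension g φ ϑ (x + ((1 : ℝ) * L : ℝ) * Complex.I) *
        Complex.exp ((1 : ℝ) * n * (x + ((1 : ℝ) * L : ℝ) * Complex.I) * Complex.I)) +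
      (∫ x in (0 : ℝ)..Real.pi, stripExtension g φ ϑ (x + ((-1 : ℝ) * L : ℝ) * Complex.I) *
        Complex.exp ((-1 : ℝ) * n * (x + ((-1 : ℝ) * L : ℝ) * Complex.I) * Complex.I)) +
      Complex.I * ∫ t in (0 : ℝ)..L, (g (Complex.cosh t) + (-1) ^ n * g (-Complex.cosh t)) *
        (singularFactor φ ϑ (Real.sinh t * Complex.I) -
          singularFactor φ ϑ (-(Real.sinh t * Complex.I))) * Complex.exp (-(n * t)) := by
  have c1 := integral_stripExtension_mul_exp hφ ϑ hL hg (σ := 1) (by simp) n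
  have c2 := integral_stripExtension_mul_exp hφ ϑ hL hg (σ := -1) (by simp) n
  have hF : ∀ σ : ℝ, IntervalIntegrable (fun x : ℝ => stripExtension g φ ϑ x *
      Complex.exp (σ * n * x * Complex.I)) MeasureTheory.volume 0 Real.pi := by
    intro σ
    refine ContinuousOn.intervalIntegrable fun x hx => ContinuousAt.continuousWithinAt ?_
    rw [uIcc_of_le Real.pi_pos.le] at hx
    refine ContinuousAt.mul (ContinuousAt.comp (g := stripExtension g φ ϑ)
      (f := fun x : ℝ => (x : ℂ)) (continuousAt_stripExtension hφ ϑ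
        (hg _ (by simpa using hx) (by simpa using hL.le)) (by simpa using hx)) (by fun_prop))
      (by fun_prop)
  have hsum : 2 * cosIntegral (endpointSingular g φ ϑ) n =
      (∫ x in (0 : ℝ)..Real.pi, stripExtension g φ ϑ x *
        Complex.exp ((1 : ℝ) * n * x * Complex.I)) +
      ∫ x in (0 : ℝ)..Real.pi, stripExtension g φ ϑ x *
        Complex.exp ((-1 : ℝ) * n * x * Complex.I) := by
    rw [← intervalIntegral.integral_add (hF 1) (hF (-1)), cosIntegral,
      ← intervalIntegral.integral_const_mul]
    refine intervalIntegral.integral_congr fun x hx => ?_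
    rw [uIcc_of_le Real.pi_pos.le] at hx
    rw [endpointSingular_cos φ ϑ g hx, stripExtension, Complex.ofReal_cos, Complex.ofReal_cos,
      Complex.ofReal_sin, show Complex.cos ((((n : ℤ) : ℝ) * x : ℝ) : ℂ) =
        (Complex.exp ((((n : ℤ) : ℝ) * x : ℝ) * Complex.I) +
          Complex.exp (-(((n : ℤ) : ℝ) * x : ℝ) * Complex.I)) / 2 from rfl]
    push_cast
    simp only [one_mul, neg_mul]
    ring
  have hcosh : ∀ t ∈ Icc 0 L, ContinuousAt (fun t : ℝ => g (Complex.cosh t)) t ∧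
      ContinuousAt (fun t : ℝ => g (-Complex.cosh t)) t := by
    intro t ht
    have ht' : |t| ≤ L := by rw [abs_of_nonneg ht.1]; exact ht.2
    have h1 := hg (t * Complex.I) (by simpa using Real.pi_pos.le) (by simpa using ht')
    have h2 := hg (t * Complex.I + Real.pi) (by simpa using Real.pi_pos.le) (by simpa using ht')
    rw [Complex.cos_mul_I] at h1
    rw [Complex.cos_add_pi, Complex.cos_mul_I] at h2
    exact ⟨ContinuousAt.comp (g := g) (f := fun t : ℝ => Complex.cosh t) h1.continuousAt
      (by fun_prop), ContinuousAt.comp (g := g) (f := fun t : ℝ => -Complex.cosh t) h2.continuousAt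
      (by fun_prop)⟩
  have hs : ∀ (σ : ℂ) (t : ℝ), σ.im = 0 → ContinuousAt
      (fun t : ℝ => singularFactor φ ϑ (σ * (Complex.sinh t * Complex.I))) t := by
    intro σ t hσ
    refine ContinuousAt.comp (g := singularFactor φ ϑ)
      (f := fun t : ℝ => σ * (Complex.sinh t * Complex.I))
      (continuousAt_singularFactor hφ ϑ (le_of_eq ?_)) (by fun_prop)
    rw [← Complex.ofReal_sinh]
    simp [hσ]
  have hI : ∀ σ : ℝ, IntervalIntegrable (fun t : ℝ => (g (Complex.cosh t) *
          singularFactor φ ϑ (σ * (Complex.sinh t * Complex.I)) -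
        (-1) ^ n * g (-Complex.cosh t) * singularFactor φ ϑ (-(σ * (Complex.sinh t * Complex.I)))) *
          Complex.exp (-(n * t))) MeasureTheory.volume 0 L := by
    intro σ
    refine ContinuousOn.intervalIntegrable fun t ht => ContinuousAt.continuousWithinAt ?_
    rw [uIcc_of_le hL.le] at ht
    obtain ⟨h1, h2⟩ := hcosh t ht
    have h3 := hs σ t (by simp)
    have h4 := hs (-σ) t (by simp)
    simp only [neg_mul] at h4
    exact ((h1.mul h3).sub ((continuousAt_const.mul h2).mul h4)).mul (by fun_prop)
  rw [hsum, c1, c2]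
  -- The vertical sides carry the factor `i σ`, so those for `σ = -1` are subtracted, and the values
  -- at `i sinh t` and `-i sinh t` pair into the jump.
  have hcomb : (∫ t in (0 : ℝ)..L, (g (Complex.cosh t) + (-1) ^ n * g (-Complex.cosh t)) *
        (singularFactor φ ϑ (Real.sinh t * Complex.I) -
          singularFactor φ ϑ (-(Real.sinh t * Complex.I))) * Complex.exp (-(n * t))) =
      (∫ t in (0 : ℝ)..L, (g (Complex.cosh t) *
          singularFactor φ ϑ ((1 : ℝ) * (Complex.sinh t * Complex.I)) -
        (-1) ^ n * g (-Complex.cosh t) *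
          singularFactor φ ϑ (-((1 : ℝ) * (Complex.sinh t * Complex.I)))) *
          Complex.exp (-(n * t))) -
      ∫ t in (0 : ℝ)..L, (g (Complex.cosh t) *
          singularFactor φ ϑ ((-1 : ℝ) * (Complex.sinh t * Complex.I)) -
        (-1) ^ n * g (-Complex.cosh t) *
          singularFactor φ ϑ (-((-1 : ℝ) * (Complex.sinh t * Complex.I)))) *
          Complex.exp (-(n * t)) := by
    rw [← intervalIntegral.integral_sub (hI 1) (hI (-1))]
    refine intervalIntegral.integral_congr fun t _ => ?_
    simp only [Complex.ofReal_sinh, Complex.ofReal_one, Complex.ofReal_neg, one_mul, neg_mul,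
      neg_neg]
    ring
  rw [hcomb]
  push_cast
  ring

/-! ### Decay and summability of the coefficients -/

/-- The decay of the Chebyshev coefficients of `endpointSingular`. -/
theorem chebCoeff_endpointSingular_isBigO {g : ℂ → ℂ} {φ : ℝ} (hφ : 0 < φ) (ϑ : ℕ)
    (hg : AnalyticOnNhd ℂ g ((fun x : ℝ => (x : ℂ)) '' Icc (-1 : ℝ) 1)) :
    (chebCoeff (endpointSingular g φ ϑ)) =O[atTop]
      fun n : ℕ => Real.log n ^ logExponent φ ϑ / (n : ℝ) ^ (2 * φ + 1) := by
  obtain ⟨L, hL, hL1, hstrip⟩ := exists_strip hg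
  set k := logExponent φ ϑ
  set p := 2 * φ with hp
  have hp0 : 0 < p := by positivity
  obtain ⟨J, hJ, hjump⟩ := exists_norm_singularFactor_sub_le φ ϑ
  obtain ⟨C, hC, hlap⟩ := exists_laplace_le hp0 k
  have htop : ∀ σ : ℝ, |σ| = 1 → ∃ B : ℝ, ∀ x ∈ Icc 0 Real.pi,
      ‖stripExtension g φ ϑ (x + (σ * L : ℝ) * Complex.I)‖ ≤ B := by
    intro σ hσ
    refine isCompact_Icc.exists_bound_of_continuousOn fun x hx =>
      ContinuousAt.continuousWithinAt ?_
    have hre : ((x : ℂ) + ((σ * L : ℝ) : ℂ) * Complex.I).re = x := by simp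
    have him : ((x : ℂ) + ((σ * L : ℝ) : ℂ) * Complex.I).im = σ * L := by simp
    have hl : |σ * L| ≤ L := by rw [abs_mul, hσ, one_mul, abs_of_pos hL]
    exact ContinuousAt.comp (g := stripExtension g φ ϑ)
      (f := fun x : ℝ => (x : ℂ) + ((σ * L : ℝ) : ℂ) * Complex.I)
      (continuousAt_stripExtension hφ ϑ (hstrip _ (by rwa [hre]) (by rwa [him])) (by rwa [hre]))
      (by fun_prop)
  have htopI : ∀ σ : ℝ, |σ| = 1 → ∃ B : ℝ, 0 ≤ B ∧ ∀ n : ℕ,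
      ‖∫ x in (0 : ℝ)..Real.pi, stripExtension g φ ϑ (x + (σ * L : ℝ) * Complex.I) *
        Complex.exp (σ * n * (x + (σ * L : ℝ) * Complex.I) * Complex.I)‖ ≤
        B * Real.exp (-L * n) := by
    intro σ hσ
    obtain ⟨B, hB⟩ := htop σ hσ
    have hB0 : 0 ≤ B := (norm_nonneg _).trans (hB 0 ⟨le_rfl, Real.pi_pos.le⟩)
    have hσ2 : σ * σ = 1 := by
      rcases eq_or_eq_neg_of_abs_eq hσ with h | h <;> rw [h] <;> norm_num
    refine ⟨B * Real.pi, by positivity, fun n => ?_⟩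
    have := intervalIntegral.norm_integral_le_of_norm_le_const (a := 0) (b := Real.pi)
      (C := B * Real.exp (-L * n)) (f := fun x : ℝ =>
        stripExtension g φ ϑ (x + (σ * L : ℝ) * Complex.I) *
        Complex.exp (σ * n * (x + (σ * L : ℝ) * Complex.I) * Complex.I)) fun x hx => ?_
    · refine this.trans (le_of_eq ?_)
      rw [sub_zero, abs_of_pos Real.pi_pos]; ring
    · rw [uIoc_of_le Real.pi_pos.le] at hx
      have he : (σ * n * (x + (σ * L : ℝ) * Complex.I) * Complex.I : ℂ) =
          ((-L * n : ℝ) : ℂ) + ((σ * n * x : ℝ) : ℂ) * Complex.I := by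
        have hσ2' : (σ : ℂ) * σ = 1 := by exact_mod_cast hσ2
        push_cast
        linear_combination (n * L * Complex.I * Complex.I : ℂ) * hσ2' +
          (n * L : ℂ) * Complex.I_mul_I
      rw [norm_mul, he, Complex.exp_add, norm_mul, Complex.norm_exp_ofReal_mul_I, mul_one,
        Complex.norm_exp, Complex.ofReal_re]
      gcongr
      exact hB x (Ioc_subset_Icc_self hx)
  obtain ⟨B₁, hB₁, h₁⟩ := htopI 1 (by simp)
  obtain ⟨B₂, hB₂, h₂⟩ := htopI (-1) (by simp)
  have hgb : ∃ G : ℝ, ∀ t ∈ Icc 0 L, ‖g (Complex.cosh t)‖ + ‖g (-Complex.cosh t)‖ ≤ G := by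
    have : ∀ σ : ℝ, σ ∈ Icc 0 Real.pi → ∃ G : ℝ, ∀ t ∈ Icc 0 L,
        ‖g (Complex.cos (t * Complex.I + σ))‖ ≤ G := by
      intro σ hσ
      refine isCompact_Icc.exists_bound_of_continuousOn fun t ht =>
        ContinuousAt.continuousWithinAt ?_
      have h := hstrip (t * Complex.I + σ) (by simpa using hσ)
        (by simpa [abs_of_nonneg ht.1] using ht.2)
      exact ContinuousAt.comp (g := g) (f := fun t : ℝ => Complex.cos (t * Complex.I + σ))
        h.continuousAt (by fun_prop)
    obtain ⟨G₁, hG₁⟩ := this 0 ⟨le_rfl, Real.pi_pos.le⟩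
    obtain ⟨G₂, hG₂⟩ := this Real.pi ⟨Real.pi_pos.le, le_rfl⟩
    refine ⟨G₁ + G₂, fun t ht => add_le_add ?_ ?_⟩
    · simpa [Complex.cos_mul_I] using hG₁ t ht
    · simpa [Complex.cos_add_pi, Complex.cos_mul_I] using hG₂ t ht
  obtain ⟨G, hG⟩ := hgb
  have hG0 : 0 ≤ G := le_trans (by positivity) (hG 0 ⟨le_rfl, hL.le⟩)
  have hmain : ∀ n : ℕ, 3 ≤ n →
      ‖∫ t in (0 : ℝ)..L, (g (Complex.cosh t) + (-1) ^ n * g (-Complex.cosh t)) *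
        (singularFactor φ ϑ (Real.sinh t * Complex.I) -
          singularFactor φ ϑ (-(Real.sinh t * Complex.I))) * Complex.exp (-(n * t))‖ ≤
      G * J * 2 ^ p * C * (Real.log n ^ k / (n : ℝ) ^ (p + 1)) := by
    intro n hn
    obtain ⟨hint, hle⟩ := hlap n hn
    have hint' := hint.const_mul (G * J * 2 ^ p)
    have hintL : IntervalIntegrable (fun t : ℝ => G * J * 2 ^ p *
        (t ^ p * (|Real.log t| + 2) ^ k * Real.exp (-(n * t)))) MeasureTheory.volume 0 L := by
      rw [intervalIntegrable_iff_integrableOn_Ioc_of_le hL.le]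
      exact MeasureTheory.IntegrableOn.mono_set hint' Ioc_subset_Ioi_self
    refine (intervalIntegral.norm_integral_le_of_norm_le hL.le ?_ hintL).trans ?_
    · refine MeasureTheory.ae_of_all _ fun t ht => ?_
      have ht0 : 0 < t := ht.1
      have ht1 : t ≤ 1 := ht.2.trans hL1
      have hs1 : t ≤ Real.sinh t := Real.self_le_sinh_iff.2 ht0.le
      have hs0 : 0 < Real.sinh t := ht0.trans_le hs1
      have hs2 : Real.sinh t ≤ 2 * t := sinh_le_two_mul ht0.le ht1
      -- On `(0, 1]` one has `t ≤ sinh t ≤ 2 t`, so the logarithms differ by at most `log 2 ≤ 1`;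
      -- hence the shift `2` in the Laplace bound.
      have hlog : |Real.log (Real.sinh t)| + 1 ≤ |Real.log t| + 2 := by
        have l1 : Real.log t ≤ Real.log (Real.sinh t) := Real.log_le_log ht0 hs1
        have l2 : Real.log (Real.sinh t) ≤ Real.log 2 + Real.log t := by
          rw [← Real.log_mul two_ne_zero ht0.ne']
          exact Real.log_le_log hs0 hs2
        have l3 : Real.log 2 ≤ 1 := by linarith [Real.log_two_lt_d9]
        have := abs_le.2 (⟨by linarith [neg_abs_le (Real.log t)],
          by linarith [le_abs_self (Real.log t)]⟩ :
          -(|Real.log t| + 1) ≤ Real.log (Real.sinh t) ∧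
            Real.log (Real.sinh t) ≤ |Real.log t| + 1)
        linarith
      have hgn : ‖g (Complex.cosh t) + (-1) ^ n * g (-Complex.cosh t)‖ ≤ G := by
        refine (norm_add_le _ _).trans ?_
        have := hG t (Ioc_subset_Icc_self ht)
        simpa using this
      have hen : ‖Complex.exp (-(n * t))‖ = Real.exp (-(n * t)) := by
        rw [Complex.norm_exp]; simp
      rw [norm_mul, norm_mul, hen]
      calc _ ≤ G * (J * (Real.sinh t ^ p * (|Real.log (Real.sinh t)| + 1) ^ k)) *
            Real.exp (-(n * t)) := by
            gcongr
            exact hjump _ hs0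
        _ ≤ G * (J * ((2 * t) ^ p * (|Real.log t| + 2) ^ k)) * Real.exp (-(n * t)) := by
            gcongr
        _ = _ := by rw [Real.mul_rpow two_pos.le ht0.le]; ring
    · rw [intervalIntegral.integral_of_le hL.le]
      calc _ ≤ ∫ t in Ioi (0 : ℝ), G * J * 2 ^ p *
            (t ^ p * (|Real.log t| + 2) ^ k * Real.exp (-(n * t))) := by
            refine MeasureTheory.setIntegral_mono_set hint' ?_
              (Eventually.of_forall Ioc_subset_Ioi_self)
            filter_upwards [MeasureTheory.ae_restrict_mem measurableSet_Ioi] with t ht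
            have ht0 : 0 < t := ht
            simp only [Pi.zero_apply]
            positivity
        _ ≤ G * J * 2 ^ p * (C * (Real.log n ^ k / (n : ℝ) ^ (p + 1))) := by
            rw [MeasureTheory.integral_const_mul]
            gcongr
        _ = _ := by ring
  have hexp : ∀ᶠ n : ℕ in atTop, Real.exp (-L * n) ≤ Real.log n ^ k / (n : ℝ) ^ (p + 1) := by
    have h := ((isLittleO_exp_neg_mul_rpow_atTop hL (-(p + 1))).comp_tendsto
      (tendsto_natCast_atTop_atTop (R := ℝ))).bound one_pos
    filter_upwards [h, eventually_ge_atTop 3] with n hn hn3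
    have hn3' : (3 : ℝ) ≤ n := by exact_mod_cast hn3
    have hn0 : (0 : ℝ) < n := by linarith
    have hlog : 1 ≤ Real.log n := by
      rw [Real.le_log_iff_exp_le hn0]
      linarith [Real.exp_one_lt_three]
    simp only [Function.comp_apply, one_mul] at hn
    rw [Real.norm_of_nonneg (by positivity), Real.norm_of_nonneg (by positivity),
      Real.rpow_neg hn0.le] at hn
    refine hn.trans ?_
    rw [← one_div]
    gcongr
    exact one_le_pow₀ hlog
  refine IsBigO.of_bound (1 / Real.pi * (B₁ + B₂ + G * J * 2 ^ p * C)) ?_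
  filter_upwards [hexp, eventually_ge_atTop 3] with n hn hn3
  have hpos : 0 ≤ Real.log n ^ k / (n : ℝ) ^ (p + 1) := (Real.exp_pos _).le.trans hn
  obtain ⟨m, rfl⟩ : ∃ m, n = m + 1 := ⟨n - 1, by omega⟩
  have e := two_mul_cosIntegral_endpointSingular hφ ϑ hL hstrip (m + 1)
  have hco : chebCoeff (endpointSingular g φ ϑ) (m + 1) =
      1 / Real.pi * (2 * cosIntegral (endpointSingular g φ ϑ) ((m + 1 : ℕ) : ℤ)) := by
    rw [chebCoeff_succ]; push_cast; ring
  rw [Real.norm_of_nonneg hpos, hco, e, norm_mul]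
  have hpi : ‖(1 / Real.pi : ℂ)‖ = 1 / Real.pi := by
    rw [norm_div, norm_one, Complex.norm_real, Real.norm_of_nonneg Real.pi_pos.le]
  rw [hpi, mul_assoc]
  have hpi0 : (0 : ℝ) ≤ 1 / Real.pi := by positivity
  refine mul_le_mul_of_nonneg_left ?_ hpi0
  refine (norm_add_le_of_le (norm_add_le_of_le (h₁ (m + 1)) (h₂ (m + 1))) (?_ : _ ≤
    G * J * 2 ^ p * C * (Real.log (m + 1 : ℕ) ^ k / ((m + 1 : ℕ) : ℝ) ^ (p + 1)))).trans ?_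
  · rw [norm_mul, Complex.norm_I, one_mul]
    exact hmain (m + 1) hn3
  · have := mul_le_mul_of_nonneg_left hn hB₁
    have := mul_le_mul_of_nonneg_left hn hB₂
    linarith

/-- Coefficients bounded by `A n / n ^ (p + 1)` with slowly varying `A` are summable. -/
theorem SlowlyVarying.summable {A : ℕ → ℝ} (hA : SlowlyVarying A) {p : ℝ} (hp : 0 < p) {a : ℕ → ℂ}
    (ha : a =O[atTop] fun n : ℕ => A n / (n : ℝ) ^ (p + 1)) : Summable a := by
  obtain ⟨M, hM⟩ := hA.exists_antitone_div (show 0 < p / 2 by positivity)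
  refine summable_of_isBigO_nat (Real.summable_nat_rpow_inv.2 (show 1 < p / 2 + 1 by linarith))
    (ha.trans (IsBigO.of_bound (A M / (M : ℝ) ^ (p / 2)) ?_))
  filter_upwards [eventually_ge_atTop (max M 1), hA.1] with n hn hpos
  have hn0 : (0 : ℝ) < n := by exact_mod_cast (le_max_right _ _).trans hn
  rw [Real.norm_of_nonneg (by positivity), Real.norm_of_nonneg (by positivity)]
  calc A n / (n : ℝ) ^ (p + 1) = A n / (n : ℝ) ^ (p / 2) * ((n : ℝ) ^ (p / 2 + 1))⁻¹ := by
        rw [← div_eq_mul_inv, div_div, ← Real.rpow_add hn0]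
        congr 2
        ring
    _ ≤ _ := by
        exact mul_le_mul_of_nonneg_right (hM M n le_rfl ((le_max_left _ _).trans hn))
          (by positivity)

end

theorem mainTheorem2 (g : ℂ → ℂ)
    (hg : AnalyticOnNhd ℂ g ((fun x : ℝ => (x : ℂ)) '' Icc (-1 : ℝ) 1))
    (φ : ℝ) (hφ : 0 < φ) (ϑ : ℕ) (u : ℝ → ℂ) (hu : u = endpointSingular g φ ϑ) :
    -- the maxima defining the three errors are attained
    (∀ N : ℕ,
      IsGreatest (errorSet u (chebTrunc u N)) (maxError u (chebTrunc u N)) ∧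
      IsGreatest (errorSet u (diffTrunc u N)) (maxError u (diffTrunc u N)) ∧
      IsGreatest (errorSet u (quadTrunc u N)) (maxError u (quadTrunc u N))) ∧
    -- the explicit slowly varying factor governs the coefficients and the errors
    SlowlyVarying (logFactor φ ϑ) ∧
    ((chebCoeff u) =O[atTop] fun n : ℕ => logFactor φ ϑ n / (n : ℝ) ^ (2 * φ + 1)) ∧
    TruncationErrorBounds u φ (logFactor φ ϑ) ∧
    -- so does every other slowly varying factor that bounds the Chebyshev coefficients
    (∀ A : ℕ → ℝ, SlowlyVarying A →
      ((chebCoeff u) =O[atTop] fun n : ℕ => A n / (n : ℝ) ^ (2 * φ + 1)) →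
      TruncationErrorBounds u φ A) := by
  subst hu
  have hc := continuousOn_endpointSingular hφ ϑ hg.continuousOn
  have hsv : SlowlyVarying (logFactor φ ϑ) := slowlyVarying_log_pow (logExponent φ ϑ)
  have ha : (chebCoeff (endpointSingular g φ ϑ)) =O[atTop]
      fun n : ℕ => logFactor φ ϑ n / (n : ℝ) ^ (2 * φ + 1) :=
    chebCoeff_endpointSingular_isBigO hφ ϑ hg
  -- Convergence of the series to `u` is settled once with the explicit factor and then serves for
  -- every `A`.
  have hs := hsv.summable (show 0 < 2 * φ by positivity) ha
  have hbounds : ∀ A : ℕ → ℝ, SlowlyVarying A →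
      ((chebCoeff (endpointSingular g φ ϑ)) =O[atTop]
        fun n : ℕ => A n / (n : ℝ) ^ (2 * φ + 1)) →
      TruncationErrorBounds (endpointSingular g φ ϑ) φ A := fun A hA hAa =>
    truncationErrorBounds hφ hA hAa (fun x hx => tendsto_chebTrunc hc hs hx)
      (endpointSingular_of_sq_eq_one hφ ϑ g (by norm_num))
      (endpointSingular_of_sq_eq_one hφ ϑ g (by norm_num))
      fun h => endpointSingular_quad h ϑ hg.continuousOn
  exact ⟨fun N => ⟨isGreatest_maxError hc (continuous_chebTrunc _ N),
    isGreatest_maxError hc (continuous_diffTrunc _ N),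
    isGreatest_maxError hc (continuous_quadTrunc _ N)⟩, hsv, ha, hbounds _ hsv ha, hbounds⟩
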